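/- **Conventions.** A *map* is a continuous function; $B_r(x)$ is the closed ball of radius $r$ about $x$; two maps $a,b$ into a metric space are $\eta$-*close* if $d(a(z),b(z))<\eta$ for all $z$. A *triangulation* $L$ of a compact polyhedron $P$ is a finite geometric simplicial complex with a homeomorphism $|L|\cong P$, by which $|L|$ is identified with $P$; $|L^{(k)}|\subset P$ is its $k$-skeleton; $\operatorname{mesh}L$ is the largest diameter of a simplex of $L$ in the metric of $P$. A *subpolyhedron* of $|L|$ is the underlying space of a finite geometric simplicial complex lying in $|L|$ (not necessarily a subcomplex of $L$). A subset of $\mathbb R^m$ is *cellular* if it is the intersection of a nested sequence of $m$-cells (subsets homeomorphic to the closed unit ball of $\mathbb R^m$), each lying in the interior of the preceding one. A space is *cell-like* if for some $m$ it embeds in $\mathbb R^m$ with cellular image. A map is *cell-like* if all its fibers are cell-like. **Lemma 3.2 (Special version of Walsh Lemma).** Let $n\ge 0$, let $\mathbf X=(P_i,f_i^{i+1})_{i\ge1}$ be an inverse sequence of compact metric polyhedra $(P_i,d_i)$ of diameter less than $1$ with surjective bonding maps, and let $L_i$ be a triangulation of $P_i$. For $i>j$ let $f_j^i:P_i\to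 P_j$ be the composite bonding map. Suppose that we have maps $g_i^{i+1}:|L_{i+1}^{(n+1)}|\to|L_i^{(n+1)}|$ with $g_i^{i+1}(|L_{i+1}^{(n)}|)\subset|L_i^{(n)}|$, and let $\mathbf Z=(|L_i^{(n)}|,g_i^{i+1})$, where $g_i^{i+1}$ stands for its restriction. Let $X=\lim\mathbf X$ and $Z=\lim\mathbf Z$. Assume that for each $i\ge 1$ we have numbers $0<\varepsilon(i)<\frac{\delta(i)}3<1$ such that: * (I) for $i\ge2$, the restrictions of $g_{i-1}^i$ and $f_{i-1}^i$ to $|L_i^{(n)}|$ are $\frac{\varepsilon(i-1)}3$-close; * (II) for $i\ge2$ and any $y\in P_i$, $\operatorname{diam} f_{i-1}^i(B_{\delta(i)}(y))<\frac{\varepsilon(i-1)}3$; * (III) for $i>j\ge 1$ and any $y\in P_i$, $\operatorname{diam} f_j^i(B_{\varepsilon(i)}(y))<\frac{\varepsilon(j)}{2^i}$. Then for every $x=(x_i)\in X$ the maps $g_i^{i+1}$ restrict to maps $B_{\delta(i+1)}(x_{i+1})\cap|L_{i+1}^{(n)}|\to B_{\delta(i)}(x_i)\cap|L_i^{(n)}|$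 and $B_{\varepsilon(i+1)}(x_{i+1})\cap|L_{i+1}^{(n)}|\to B_{\varepsilon(i)}(x_i)\cap|L_i^{(n)}|$, and there is a map $\pi:Z\to X$ such that for every $x=(x_i)\in X$ $$\pi^{-1}(x)=\lim\bigl(B_{\delta(i)}(x_i)\cap|L_i^{(n)}|,\,g_i^{i+1}\bigr)=\lim\bigl(B_{\varepsilon(i)}(x_i)\cap|L_i^{(n)}|,\,g_i^{i+1}\bigr).$$ If, in addition, * (IV) $\operatorname{mesh}L_i<\varepsilon(i)$ for all $i$, then $\pi^{-1}(x)\ne\emptyset$ for all $x\in X$, so $\pi$ is surjective. If, besides (IV), we also have * (V) for all $i\ge1$ and $y\in P_i$ there is a contractible subpolyhedron $P_{y,i}$ of $|L_i|$ with $B_{\varepsilon(i)}(y)\subset P_{y,i}\subset B_{\delta(i)}(y)$, and * (VI) for all $i\ge2$, $g_{i-1}^i(|L_i^{(n+1)}|)\subset|L_{i-1}^{(n)}|$, then $\pi$ is cell-like. -/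

import Mathlib

open Set Topology

/-- The limit of an inverse sequence `M 0 ← M 1 ← M 2 ← ⋯`: the subspace of threads of the
product. -/
abbrev InvLimit {M : ℕ → Type*} (g : ∀ i, M (i + 1) → M i) : Type _ :=
  {x : ∀ i, M i // ∀ i, g i (x (i + 1)) = x i}

/-- The composite bonding map `M (j + k) → M j` of an inverse sequence. -/
def bondComp {M : ℕ → Type*} (f : ∀ i, M (i + 1) → M i) (j : ℕ) : ∀ k : ℕ, M (j + k) → M j
  | 0 => fun x => x
  | k + 1 => fun x => bondComp f j k (f (j + k) x)

/-- A triangulation of a compact polyhedron `P`: a finite geometric simplicial complex in some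
Euclidean space, together with a homeomorphism of its underlying space onto `P`. -/
structure Triangulation (P : Type*) [TopologicalSpace P] where
  /-- dimension of the ambient Euclidean space -/
  ambientDim : ℕ
  complex : Geometry.SimplicialComplex ℝ (EuclideanSpace ℝ (Fin ambientDim))
  finite_faces : complex.faces.Finite
  homeo : complex.space ≃ₜ P

namespace Triangulation

variable {P : Type*} [TopologicalSpace P] (L : Triangulation P)

/-- The point of the geometric complex that corresponds to a point of `P`. -/
def point (p : P) : EuclideanSpace ℝ (Fin L.ambientDim) := (L.homeo.symm p : _)

/-- The closed simplex of `P` with vertex set `s`. -/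
def simplex (s : Finset (EuclideanSpace ℝ (Fin L.ambientDim))) : Set P :=
  {p | L.point p ∈ convexHull ℝ (s : Set (EuclideanSpace ℝ (Fin L.ambientDim)))}

/-- The underlying set `|L^(n)| ⊆ P` of the `n`-skeleton: the union of all simplices of dimension
at most `n`, that is, with at most `n + 1` vertices. -/
def skeleton (n : ℕ) : Set P :=
  {p | ∃ s ∈ L.complex.faces, s.card ≤ n + 1 ∧ p ∈ L.simplex s}

theorem skeleton_subset_succ (n : ℕ) : L.skeleton n ⊆ L.skeleton (n + 1) := by
  rintro p ⟨s, hs, hc, hp⟩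
  exact ⟨s, hs, by omega, hp⟩

/-- `A ⊆ P` is a (compact) subpolyhedron of `|L|`: it corresponds to the underlying space of some
finite geometric simplicial complex lying in `|L|`. This complex need not be a subcomplex
of `L`. -/
def IsSubpolyhedron (A : Set P) : Prop :=
  ∃ J : Geometry.SimplicialComplex ℝ (EuclideanSpace ℝ (Fin L.ambientDim)),
    J.faces.Finite ∧ J.space = L.point '' A

end Triangulation

/-- The mesh of a triangulation: the largest diameter of its simplices in the metric of `P`. -/
noncomputable def Triangulation.mesh {P : Type*} [MetricSpace P] (L : Triangulation P) : ℝ :=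
  ⨆ s : L.complex.faces, Metric.diam (L.simplex s)

/-- The restriction to the `n`-skeleta of a map between `(n + 1)`-skeleta that maps the
`n`-skeleton into the `n`-skeleton. -/
def skeletonRestrict {P Q : Type*} [TopologicalSpace P] [TopologicalSpace Q]
    (K : Triangulation Q) (L : Triangulation P) (n : ℕ)
    (g : K.skeleton (n + 1) → L.skeleton (n + 1))
    (hg : ∀ z : K.skeleton (n + 1), (z : Q) ∈ K.skeleton n → (g z : P) ∈ L.skeleton n) :
    K.skeleton n → L.skeleton n :=
  fun z => ⟨g ⟨z, K.skeleton_subset_succ n z.2⟩, hg ⟨z, K.skeleton_subset_succ n z.2⟩ z.2⟩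

/-- An `m`-cell in `ℝ^m`: a subset homeomorphic to the closed unit ball. -/
def IsCell {m : ℕ} (C : Set (EuclideanSpace ℝ (Fin m))) : Prop :=
  Nonempty (C ≃ₜ Metric.closedBall (0 : EuclideanSpace ℝ (Fin m)) 1)

/-- A cellular subset of `ℝ^m`: the intersection of a nested sequence of `m`-cells, each lying in
the interior of the preceding one. -/
def IsCellular {m : ℕ} (A : Set (EuclideanSpace ℝ (Fin m))) : Prop :=
  ∃ C : ℕ → Set (EuclideanSpace ℝ (Fin m)),
    (∀ k, IsCell (C k)) ∧ (∀ k, C (k + 1) ⊆ interior (C k)) ∧ A = ⋂ k, C k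

/-- A cell-like space: it embeds in some `ℝ^m` with cellular image. -/
def IsCellLikeSpace (Y : Type*) [TopologicalSpace Y] : Prop :=
  ∃ (m : ℕ) (F : Y → EuclideanSpace ℝ (Fin m)), IsEmbedding F ∧ IsCellular (range F)

/-- A cell-like map: all its fibers are cell-like spaces. -/
def IsCellLikeMap {Z X : Type*} [TopologicalSpace Z] (π : Z → X) : Prop :=
  ∀ x, IsCellLikeSpace (π ⁻¹' {x})

/-! A thread `z` of the skeleta is almost a thread of `f`: by (I), `z_i` and `f_i (z_{i+1})` are
closer than `ε i / 3`, so by (III) the images of `z_{j+k}` in `P j` form a Cauchy sequence with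
geometric errors. Its limits, over all `j`, form `π z`, and `z_j` stays within `ε j / 3 + ε j / 2`
of `(π z)_j`; this gives the fibers in terms of `ε`-balls. By (I) and (II) a bonding map carries the
whole `δ`-ball into the `ε`-ball, so both systems of balls have the same limit. Under (IV) every
ball meets the skeleton, and compactness yields a thread (`exists_fiber_map`,
`exists_thread_mem_closedBall`).

For cell-likeness, let `K i` be the part of the `n`-skeleton in the `ε i`-ball about `x_i`. The
composite `K (i+2) → K (i+1) → K i` factors through the cone on `K (i+2)` (`exists_extension_comp`).
A contractible polyhedron is an absolute extensor, so the inclusion of `K (i+2)` extends over the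
cone, with values in the polyhedron from (V). The cone has dimension `n + 1`, so this extension can
be pushed into the `(n+1)`-skeleton relative to `K (i+2)`. By (VI), `g` takes it into the
`n`-skeleton one level down. That skeleton maps to itself near the next contractible polyhedron,
fixing its points there, and one more bonding map lands in `K i`. Hence the fiber is the limit of
the cones on the `K (2j)`.

A limit of such cones is cellular in some `ℝ^(m+k)` (`isCellLikeSpace_of_starConvex_tower`). Each
cone embeds in `ℝ^m` by general position. Klee's trick moves the copy in `ℝ^m × 0` to a star-shaped
set in `0 × ℝ^k`, so it has small cell neighbourhoods. Choosing each embedding very close to the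
preceding one composed with the bonding map makes the cells nested and the embeddings converge to an
embedding of the limit onto the intersection of the cells.

General position rests on Hausdorff dimension of `C¹` images. One operation on barycentric
coordinates, `trim`, serves both for pushing into skeleta and for extending maps into complexes. -/

section

open scoped NNReal Pointwise

/-! ### Thin spaces and embeddings in general position -/

/-- `A` is covered by finitely many `C¹` images of `ℝ^d`. -/
def IsThinSet (d : ℕ) {E : Type*} [NormedAddCommGroup E] [NormedSpace ℝ E] (A : Set E) : Prop :=
  ∃ (k : ℕ) (φ : Fin k → (Fin d → ℝ) → E), (∀ i, ContDiff ℝ 1 (φ i)) ∧ A ⊆ ⋃ i, range (φ i)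

/-- `Q` embeds in a Euclidean space as a subset of a finite union of `C¹` images of `ℝ^d`. -/
def ThinSpace (d : ℕ) (Q : Type*) [TopologicalSpace Q] : Prop :=
  ∃ (N : ℕ) (ι : Q → EuclideanSpace ℝ (Fin N)),
    Continuous ι ∧ Function.Injective ι ∧ IsThinSet d (range ι)

theorem ThinSpace.of_injective {d : ℕ} {Q Q' : Type*} [TopologicalSpace Q] [TopologicalSpace Q']
    (h : ThinSpace d Q) (e : Q' → Q) (he : Continuous e) (hi : Function.Injective e) :
    ThinSpace d Q' := by
  obtain ⟨N, ι, hc, hinj, k, φ, hφ, hs⟩ := h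
  refine ⟨N, ι ∘ e, hc.comp he, hinj.comp hi, k, φ, hφ, ?_⟩
  exact (range_comp_subset_range e ι).trans hs

theorem IsThinSet.image {d : ℕ} {E F : Type*} [NormedAddCommGroup E] [NormedSpace ℝ E]
    [NormedAddCommGroup F] [NormedSpace ℝ F] {A : Set E} (h : IsThinSet d A) {G : E → F}
    (hG : ContDiff ℝ 1 G) : IsThinSet d (G '' A) := by
  obtain ⟨k, φ, hφ, hs⟩ := h
  refine ⟨k, fun i => G ∘ φ i, fun i => hG.comp (hφ i), ?_⟩
  rintro _ ⟨a, ha, rfl⟩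
  obtain ⟨i, u, rfl⟩ := mem_iUnion.1 (hs ha)
  exact mem_iUnion.2 ⟨i, u, rfl⟩

/-- Continuous functions on a compact subspace of a Euclidean space are approximable by
`C¹` functions. -/
theorem exists_contDiff_approx {Q : Type*} [TopologicalSpace Q] [CompactSpace Q] {N : ℕ}
    (ι : Q → EuclideanSpace ℝ (Fin N)) (hc : Continuous ι) (hi : Function.Injective ι)
    (h : Q → ℝ) (hh : Continuous h) {η : ℝ} (hη : 0 < η) :
    ∃ H : EuclideanSpace ℝ (Fin N) → ℝ, ContDiff ℝ 1 H ∧ ∀ x, |H (ι x) - h x| < η := by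
  -- Stone–Weierstrass for the algebra of restrictions of `C¹` functions; the coordinates of `ι`
  -- separate points.
  let A : Subalgebra ℝ C(Q, ℝ) :=
    { carrier := {f | ∃ H : EuclideanSpace ℝ (Fin N) → ℝ, ContDiff ℝ 1 H ∧ ∀ x, f x = H (ι x)}
      mul_mem' := by
        rintro f g ⟨F, hF, hf⟩ ⟨G, hG, hg⟩
        exact ⟨fun x => F x * G x, hF.mul hG, fun x => by simp [hf, hg]⟩
      add_mem' := by
        rintro f g ⟨F, hF, hf⟩ ⟨G, hG, hg⟩
        exact ⟨fun x => F x + G x, hF.add hG, fun x => by simp [hf, hg]⟩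
      algebraMap_mem' := fun r => ⟨fun _ => r, contDiff_const, fun x => by simp⟩ }
  have hA : A.SeparatesPoints := by
    intro x y hxy
    have : ι x ≠ ι y := fun e => hxy (hi e)
    obtain ⟨k, hk⟩ : ∃ k, ι x k ≠ ι y k := by
      by_contra! hcon
      exact this (by ext k; exact hcon k)
    refine ⟨fun z => ι z k, ⟨⟨fun z => ι z k, by fun_prop⟩, ⟨fun v => v k, by fun_prop, fun x => rfl⟩,
      rfl⟩, hk⟩
  obtain ⟨g, hg⟩ := ContinuousMap.exists_mem_subalgebra_near_continuous_of_separatesPoints A hA h hh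
    η hη
  obtain ⟨H, hH, hgH⟩ := g.2
  refine ⟨H, hH, fun x => ?_⟩
  have := hg x
  rw [hgH x] at this
  simpa using this

theorem dimH_iUnion_le_natCast {κ X : Type*} [Countable κ] [EMetricSpace X] (A : κ → Set X) (D : ℕ)
    (h : ∀ i, dimH (A i) ≤ D) : dimH (⋃ i, A i) ≤ D := by
  rw [dimH_iUnion]
  exact iSup_le h

/-- Adding a generic small multiple of a coordinate functional separates the pairs of points of a
thin set which that functional separates. -/
theorem exists_small_separating {d m : ℕ} (hm : 2 * d < m) {E : Type*} [NormedAddCommGroup E]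
    [NormedSpace ℝ E] {A : Set E} (hA : IsThinSet d A) (ℓ : E →L[ℝ] ℝ)
    (G : E → EuclideanSpace ℝ (Fin m)) (hG : ContDiff ℝ 1 G) {η : ℝ} (hη : 0 < η) :
    ∃ w : EuclideanSpace ℝ (Fin m), ‖w‖ < η ∧ ∀ x ∈ A, ∀ y ∈ A, ℓ x ≠ ℓ y →
      G x + ℓ x • w ≠ G y + ℓ y • w := by
  obtain ⟨k, φ, hφ, hs⟩ := hA
  -- `Ψ` solves `G x + ℓ x • w = G y + ℓ y • w` for `w`. The bad `w` are thus locally Lipschitz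
  -- images of subsets of a `2d`-dimensional space, and cannot fill a ball of `ℝ^m`.
  let Ψ : Fin k → Fin k → (Fin d → ℝ) × (Fin d → ℝ) → EuclideanSpace ℝ (Fin m) := fun i j p =>
    (ℓ (φ i p.1) - ℓ (φ j p.2))⁻¹ • (G (φ j p.2) - G (φ i p.1))
  let U : Fin k → Fin k → Set ((Fin d → ℝ) × (Fin d → ℝ)) := fun i j =>
    {p | ℓ (φ i p.1) - ℓ (φ j p.2) ≠ 0}
  have hl1 : ∀ i, ContDiff ℝ 1 (fun p : (Fin d → ℝ) × (Fin d → ℝ) => φ i p.1) := fun i =>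
    (hφ i).comp contDiff_fst
  have hl2 : ∀ i, ContDiff ℝ 1 (fun p : (Fin d → ℝ) × (Fin d → ℝ) => φ i p.2) := fun i =>
    (hφ i).comp contDiff_snd
  have hℓ : ∀ i j, ContDiff ℝ 1 (fun p : (Fin d → ℝ) × (Fin d → ℝ) =>
      ℓ (φ i p.1) - ℓ (φ j p.2)) := fun i j =>
    (ℓ.contDiff.comp (hl1 i)).sub (ℓ.contDiff.comp (hl2 j))
  have hdim : ∀ i j, dimH (Ψ i j '' U i j) ≤ (2 * d : ℕ) := by
    intro i j
    have hopen : IsOpen (U i j) := isOpen_ne_fun (hℓ i j).continuous continuous_const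
    have hcd : ContDiffOn ℝ 1 (Ψ i j) (U i j) := by
      have h1 : ContDiffOn ℝ 1 (fun p : (Fin d → ℝ) × (Fin d → ℝ) =>
          (ℓ (φ i p.1) - ℓ (φ j p.2))⁻¹) (U i j) := (hℓ i j).contDiffOn.inv (fun p hp => hp)
      exact h1.smul ((hG.comp (hl2 j)).sub (hG.comp (hl1 i))).contDiffOn
    have hle : dimH (Ψ i j '' U i j) ≤ dimH (U i j) := by
      refine dimH_image_le_of_locally_lipschitzOn ?_
      intro p hp
      have h1 : ContDiffAt ℝ 1 (Ψ i j) p := hcd.contDiffAt (hopen.mem_nhds hp)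
      obtain ⟨C, t, ht, hC⟩ := h1.exists_lipschitzOnWith
      exact ⟨C, t, mem_nhdsWithin_of_mem_nhds ht, hC⟩
    refine hle.trans ((dimH_mono (subset_univ _)).trans ?_)
    rw [Real.dimH_univ_eq_finrank]
    simp [two_mul]
  have hbad : dimH (⋃ q : Fin k × Fin k, Ψ q.1 q.2 '' U q.1 q.2) <
      Module.finrank ℝ (EuclideanSpace ℝ (Fin m)) := by
    refine (dimH_iUnion_le_natCast (fun q : Fin k × Fin k => Ψ q.1 q.2 '' U q.1 q.2) (2 * d) (fun q => hdim q.1 q.2)).trans_lt ?_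
    simp only [finrank_euclideanSpace, Fintype.card_fin]
    exact_mod_cast hm
  obtain ⟨w, hw, hwb⟩ := (dense_compl_of_dimH_lt_finrank hbad).exists_dist_lt 0 hη
  refine ⟨w, by simpa [dist_eq_norm] using hwb, fun x hx y hy hxy heq => hw ?_⟩
  obtain ⟨i, u, rfl⟩ := mem_iUnion.1 (hs hx)
  obtain ⟨j, v, rfl⟩ := mem_iUnion.1 (hs hy)
  refine mem_iUnion.2 ⟨(i, j), (u, v), sub_ne_zero.2 hxy, ?_⟩
  have h0 := sub_ne_zero.2 hxy
  change (ℓ (φ i u) - ℓ (φ j v))⁻¹ • (G (φ j v) - G (φ i u)) = w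
  rw [inv_smul_eq_iff₀ h0, sub_smul, sub_eq_sub_iff_add_eq_add,
    add_comm (ℓ (φ i u) • w)]
  exact heq.symm

/-- Maps of a compact `d`-dimensional thin space into `ℝ^m`, `m ≥ 2d + 1`, are approximable by
injective maps whose image is again thin. -/
theorem ThinSpace.exists_injective_approx {d m : ℕ} (hm : 2 * d < m) {Q : Type*}
    [TopologicalSpace Q] [CompactSpace Q] (hQ : ThinSpace d Q)
    (φ : Q → EuclideanSpace ℝ (Fin m)) (hφ : Continuous φ) {η : ℝ} (hη : 0 < η) :
    ∃ e : Q → EuclideanSpace ℝ (Fin m), Continuous e ∧ Function.Injective e ∧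
      IsThinSet d (range e) ∧ ∀ x, dist (e x) (φ x) < η := by
  obtain ⟨N, ι, hc, hi, hthin⟩ := hQ
  -- a `C¹` approximation
  obtain ⟨G₀, hG₀, hG₀φ⟩ : ∃ G : EuclideanSpace ℝ (Fin N) → EuclideanSpace ℝ (Fin m),
      ContDiff ℝ 1 G ∧ ∀ x, dist (G (ι x)) (φ x) < η := by
    have hpos : (0 : ℝ) < η / (m + 1) := by positivity
    choose H hH hHφ using fun k : Fin m => exists_contDiff_approx ι hc hi (fun x => φ x k)
      (by fun_prop) hpos
    refine ⟨fun v => WithLp.toLp 2 (fun k => H k v), ?_, fun x => ?_⟩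
    · rw [contDiff_euclidean]
      exact hH
    · rw [EuclideanSpace.dist_eq]
      have h1 : ∀ k, dist (H k (ι x)) (φ x k) ^ 2 ≤ (η / (m + 1)) ^ 2 := fun k => by
        have := (hHφ k x).le
        rw [Real.dist_eq]
        gcongr
      have h2 : ∑ k, dist (H k (ι x)) (φ x k) ^ 2 ≤ m * (η / (m + 1)) ^ 2 := by
        refine (Finset.sum_le_sum fun k _ => h1 k).trans ?_
        simp
      rw [Real.sqrt_lt' hη]
      refine h2.trans_lt ?_
      rw [div_pow, mul_div_assoc', div_lt_iff₀ (by positivity)]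
      have : 0 < η ^ 2 := by positivity
      have hm0 : (0 : ℝ) ≤ m := Nat.cast_nonneg m
      have : (m : ℝ) < (m + 1) ^ 2 := by nlinarith
      nlinarith
  -- The coordinates of `ι` are treated one at a time. A multiple of the new coordinate is added, so
  -- pairs agreeing in it keep their earlier separation, and pairs differing in it are separated by
  -- the choice of `w`.
  have key : ∀ s : Finset (Fin N), ∃ G : EuclideanSpace ℝ (Fin N) → EuclideanSpace ℝ (Fin m),
      ContDiff ℝ 1 G ∧ (∀ x, dist (G (ι x)) (φ x) < η) ∧
      ∀ x ∈ range ι, ∀ y ∈ range ι, (∃ k ∈ s, x k ≠ y k) → G x ≠ G y := by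
    intro s
    induction s using Finset.induction_on with
    | empty => exact ⟨G₀, hG₀, hG₀φ, by simp⟩
    | insert k s hk ih =>
      obtain ⟨G, hG, hGφ, hsep⟩ := ih
      rcases isEmpty_or_nonempty Q with hQ | hQ
      · exact ⟨G, hG, hGφ, by simp⟩
      let ℓ : EuclideanSpace ℝ (Fin N) →L[ℝ] ℝ := EuclideanSpace.proj k
      obtain ⟨x₀, -, hx₀⟩ := isCompact_univ.exists_isMaxOn (univ_nonempty (α := Q))
        (f := fun x => dist (G (ι x)) (φ x))
        (by have := hG.continuous; fun_prop)
      obtain ⟨x₁, -, hx₁⟩ := isCompact_univ.exists_isMaxOn (univ_nonempty (α := Q))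
        (f := fun x => |ℓ (ι x)|) (by fun_prop)
      set B := |ℓ (ι x₁)| with hB
      have hBnn : 0 ≤ B := abs_nonneg _
      -- By compactness the approximation has a positive margin `μ`, which bounds the size of the
      -- next correction.
      set μ := η - dist (G (ι x₀)) (φ x₀) with hμ
      have hμpos : 0 < μ := sub_pos.2 (hGφ x₀)
      obtain ⟨w, hw, hwsep⟩ := exists_small_separating hm hthin ℓ G hG
        (η := μ / (B + 1)) (by positivity)
      refine ⟨fun v => G v + ℓ v • w, by fun_prop, fun x => ?_, ?_⟩
      · have h1 : dist (G (ι x)) (φ x) ≤ η - μ := by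
          have := hx₀ (mem_univ x)
          simp only [mem_ofPred_eq] at this
          linarith
        have h2 : ‖ℓ (ι x) • w‖ < μ := by
          rw [norm_smul, Real.norm_eq_abs]
          have h3 : |ℓ (ι x)| ≤ B := hx₁ (mem_univ x)
          calc |ℓ (ι x)| * ‖w‖ ≤ B * ‖w‖ := by gcongr
            _ ≤ (B + 1) * ‖w‖ := by nlinarith [norm_nonneg w]
            _ < (B + 1) * (μ / (B + 1)) := by gcongr
            _ = μ := by field_simp
        calc dist (G (ι x) + ℓ (ι x) • w) (φ x)
            ≤ dist (G (ι x) + ℓ (ι x) • w) (G (ι x)) + dist (G (ι x)) (φ x) :=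
              dist_triangle _ _ _
          _ = ‖ℓ (ι x) • w‖ + dist (G (ι x)) (φ x) := by simp [dist_eq_norm]
          _ < η := by linarith
      · intro x hx y hy hxy
        by_cases hk' : ℓ x = ℓ y
        · obtain ⟨j, hj, hjne⟩ := hxy
          rcases Finset.mem_insert.1 hj with rfl | hj
          · exact absurd hk' hjne
          · have := hsep x hx y hy ⟨j, hj, hjne⟩
            simpa [hk'] using this
        · exact hwsep x hx y hy hk'
  obtain ⟨G, hG, hGφ, hsep⟩ := key Finset.univ
  refine ⟨fun x => G (ι x), hG.continuous.comp hc, fun x y hxy => ?_, ?_, hGφ⟩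
  · by_contra hne
    have : ι x ≠ ι y := fun e => hne (hi e)
    obtain ⟨k, hk⟩ : ∃ k, ι x k ≠ ι y k := by
      by_contra! hcon
      exact this (by ext k; exact hcon k)
    exact hsep _ (mem_range_self x) _ (mem_range_self y) ⟨k, Finset.mem_univ _, hk⟩ hxy
  · have := hthin.image hG
    rwa [← range_comp] at this

/-! ### Trimming barycentric coordinates -/

section Trim

set_option linter.unusedSectionVars false

variable {V : Type*} [Fintype V]

/-- The support of a weight function. -/
noncomputable def wsupp (lam : V → ℝ≥0) : Finset V := Finset.univ.filter fun v => lam v ≠ 0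

@[simp] theorem mem_wsupp {lam : V → ℝ≥0} {v : V} : v ∈ wsupp lam ↔ lam v ≠ 0 := by
  simp [wsupp]

/-- The largest value `t` such that all weights on some forbidden set are at least `t`. -/
noncomputable def threshold {κ : Type*} [Fintype κ] (S : κ → Finset V) (hS : ∀ i, (S i).Nonempty)
    (lam : V → ℝ≥0) : ℝ≥0 :=
  Finset.univ.sup fun i => (S i).inf' (hS i) lam

/-- Subtract the threshold and renormalise: this removes the forbidden sets from the support. -/
noncomputable def trim {κ : Type*} [Fintype κ] (S : κ → Finset V) (hS : ∀ i, (S i).Nonempty)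
    (lam : V → ℝ≥0) : V → ℝ≥0 :=
  fun v => (lam v - threshold S hS lam) / ∑ w, (lam w - threshold S hS lam)

variable {κ : Type*} [Fintype κ] (S : κ → Finset V) (hS : ∀ i, (S i).Nonempty)

theorem continuous_threshold : Continuous (threshold S hS) := by
  unfold threshold
  refine Continuous.finset_sup_apply fun i _ => ?_
  exact Continuous.finset_inf'_apply (hS i) fun v _ => continuous_apply v

theorem le_threshold (lam : V → ℝ≥0) (i : κ) (t : ℝ≥0) (h : ∀ v ∈ S i, t ≤ lam v) :
    t ≤ threshold S hS lam :=
  (Finset.le_inf' _ _ h).trans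
    (Finset.le_sup (f := fun i => (S i).inf' (hS i) lam) (Finset.mem_univ i))

theorem exists_le_of_le_threshold (lam : V → ℝ≥0) {t : ℝ≥0} (ht : 0 < t)
    (h : t ≤ threshold S hS lam) : ∃ i, ∀ v ∈ S i, t ≤ lam v := by
  obtain ⟨i, -, hi⟩ := (Finset.le_sup_iff ht).1 h
  exact ⟨i, fun v hv => hi.trans (Finset.inf'_le _ hv)⟩

theorem threshold_eq_zero (lam : V → ℝ≥0) (h : ∀ i, ¬ S i ⊆ wsupp lam) :
    threshold S hS lam = 0 := by
  by_contra hne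
  obtain ⟨i, hi⟩ := exists_le_of_le_threshold S hS lam (pos_iff_ne_zero.2 hne) le_rfl
  exact h i fun v hv => mem_wsupp.2 ((pos_iff_ne_zero.2 hne).trans_le (hi v hv)).ne'

theorem sum_trim (lam : V → ℝ≥0) (h : ∃ v, threshold S hS lam < lam v) :
    ∑ v, trim S hS lam v = 1 := by
  obtain ⟨v, hv⟩ := h
  unfold trim
  rw [← Finset.sum_div, div_self]
  exact (Finset.sum_pos' (f := fun w => lam w - threshold S hS lam) (fun _ _ => zero_le)
    ⟨v, Finset.mem_univ v, tsub_pos_of_lt hv⟩).ne'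

theorem wsupp_trim_subset (lam : V → ℝ≥0) : wsupp (trim S hS lam) ⊆ wsupp lam := by
  intro v hv
  rw [mem_wsupp] at hv ⊢
  intro h0
  exact hv (by simp [trim, h0])

/-- If all weights on `S i` survived the subtraction, their minimum would exceed the threshold,
which is the largest of these minima. -/
theorem not_subset_wsupp_trim (lam : V → ℝ≥0) (i : κ) : ¬ S i ⊆ wsupp (trim S hS lam) := by
  intro hsub
  have hlt : ∀ v ∈ S i, threshold S hS lam < lam v := by
    intro v hv
    have := mem_wsupp.1 (hsub hv)
    by_contra hle
    exact this (by simp [trim, tsub_eq_zero_of_le (not_lt.1 hle)])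
  have h1 : threshold S hS lam < (S i).inf' (hS i) lam := (Finset.lt_inf'_iff _).2 hlt
  exact absurd (Finset.le_sup (f := fun i => (S i).inf' (hS i) lam) (Finset.mem_univ i))
    (not_le.2 h1)

theorem trim_eq_self (lam : V → ℝ≥0) (hsum : ∑ v, lam v = 1) (h : ∀ i, ¬ S i ⊆ wsupp lam) :
    trim S hS lam = lam := by
  funext v
  simp [trim, threshold_eq_zero S hS lam h, hsum]

/-- The only obstruction is a vanishing denominator, that is, every weight being at most the
threshold. -/
theorem continuousAt_trim (lam : V → ℝ≥0) (h : ∃ v, threshold S hS lam < lam v) :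
    ContinuousAt (trim S hS) lam := by
  obtain ⟨v, hv⟩ := h
  have hc := continuous_threshold S hS
  have hne : ∑ w, (lam w - threshold S hS lam) ≠ 0 :=
    (Finset.sum_pos' (f := fun w => lam w - threshold S hS lam) (fun _ _ => zero_le)
    ⟨v, Finset.mem_univ v, tsub_pos_of_lt hv⟩).ne'
  rw [continuousAt_pi]
  intro w
  unfold trim
  refine ContinuousAt.div₀ ?_ ?_ hne
  · exact ((continuous_apply w).sub hc).continuousAt
  · exact (continuous_finsetSum _ fun w _ => (continuous_apply w).sub hc).continuousAt

end Trim

/-! ### Pushing maps into a skeleton -/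

theorem exists_small_generic_translation {d : ℕ} {V : Type*} [Fintype V] {E : Type*}
    [NormedAddCommGroup E] [NormedSpace ℝ E] {A : Set E} (hA : IsThinSet d A) (H : E → V → ℝ)
    (hH : ContDiff ℝ 1 H) {η : ℝ} (hη : 0 < η) :
    ∃ t : V → ℝ, (∀ v, |t v| < η) ∧ ∀ x ∈ A, ∀ S : Finset V, S.card = d + 2 →
      ∀ M : ℝ, ¬ ∀ v ∈ S, H x v + t v = M := by
  classical
  obtain ⟨k, φ, hφ, hs⟩ := hA
  have hdim : ∀ (i : Fin k) (S : {S : Finset V // S.card = d + 2}),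
      dimH {t : V → ℝ | ∃ u M, ∀ v ∈ S.1, H (φ i u) v + t v = M} ≤
        (Fintype.card V - 1 : ℕ) := by
    rintro i ⟨S, hS⟩
    obtain ⟨v₀, hv₀⟩ : S.Nonempty := Finset.card_pos.1 (by omega)
    -- A bad `t` is determined by `u`, the common value on `S`, and the values off `S`. Collapsing
    -- `S` to `v₀` leaves `|V| - (d + 1)` such values, so the bad set has dimension at most `d + |V|
    -- - (d + 1) = |V| - 1`.
    let V' := {v : V // v ∈ (S.erase v₀)ᶜ}
    let ρ : V → V' := fun v => if hv : v ∈ (S.erase v₀)ᶜ then ⟨v, hv⟩ else ⟨v₀, by simp⟩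
    let Ψ : (Fin d → ℝ) × (V' → ℝ) → V → ℝ := fun p v => p.2 (ρ v) - H (φ i p.1) v
    have hΨ : ContDiff ℝ 1 Ψ := by
      have h1 : ContDiff ℝ 1 (fun p : (Fin d → ℝ) × (V' → ℝ) => H (φ i p.1)) :=
        hH.comp ((hφ i).comp contDiff_fst)
      rw [contDiff_pi] at h1 ⊢
      intro v
      refine ContDiff.sub ?_ (h1 v)
      exact (contDiff_apply ℝ ℝ (ρ v)).comp contDiff_snd
    have hsub : {t : V → ℝ | ∃ u M, ∀ v ∈ S, H (φ i u) v + t v = M} ⊆ range Ψ := by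
      rintro t ⟨u, M, hM⟩
      refine ⟨(u, fun w => t w + H (φ i u) w), ?_⟩
      funext v
      by_cases hv : v ∈ (S.erase v₀)ᶜ
      · simp only [Ψ, ρ, hv, dif_pos]
        ring
      · have hvS : v ∈ S := by
          simp only [Finset.mem_compl, not_not] at hv
          exact Finset.mem_of_mem_erase hv
        simp only [Ψ, ρ, hv, dif_neg, not_false_eq_true]
        have h1 := hM v hvS
        have h2 := hM v₀ hv₀
        linarith
    refine (dimH_mono hsub).trans (hΨ.dimH_range_le.trans ?_)
    have hcard : Fintype.card V' = Fintype.card V - (d + 1) := by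
      rw [Fintype.card_coe, Finset.card_compl, Finset.card_erase_of_mem hv₀, hS]
      rfl
    have hle : S.card ≤ Fintype.card V := Finset.card_le_univ S
    simp only [Module.finrank_prod, Module.finrank_fintype_fun_eq_card, Fintype.card_fin, hcard]
    exact_mod_cast (by omega : d + (Fintype.card V - (d + 1)) ≤ Fintype.card V - 1)
  let bad : Set (V → ℝ) := ⋃ q : Fin k × {S : Finset V // S.card = d + 2},
    {t : V → ℝ | ∃ u M, ∀ v ∈ q.2.1, H (φ q.1 u) v + t v = M}
  have hdense : Dense badᶜ := by
    rcases isEmpty_or_nonempty {S : Finset V // S.card = d + 2} with h | ⟨⟨S, hS⟩⟩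
    · have : bad = ∅ := by simp [bad]
      rw [this, compl_empty]
      exact dense_univ
    · refine dense_compl_of_dimH_lt_finrank ((dimH_iUnion_le_natCast _ _
        fun q : Fin k × {S : Finset V // S.card = d + 2} => hdim q.1 q.2).trans_lt ?_)
      have hle : S.card ≤ Fintype.card V := Finset.card_le_univ S
      rw [Module.finrank_fintype_fun_eq_card]
      exact_mod_cast (by omega : Fintype.card V - 1 < Fintype.card V)
  obtain ⟨t, ht, htη⟩ := hdense.exists_dist_lt 0 hη
  refine ⟨t, fun v => ?_, fun x hx S hS M hM => ht ?_⟩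
  · rw [dist_comm, dist_pi_lt_iff hη] at htη
    simpa [Real.dist_eq] using htη v
  · obtain ⟨i, u, rfl⟩ := mem_iUnion.1 (hs hx)
    exact mem_iUnion.2 ⟨(i, ⟨S, hS⟩), u, M, hM⟩

/-- A map from a `d`-dimensional space to a simplex can be pushed, within the carriers, into the
`d`-skeleton, relative to the points already there. -/
theorem ThinSpace.exists_push {d : ℕ} {Q : Type*} [TopologicalSpace Q] [CompactSpace Q]
    (hQ : ThinSpace d Q) {V : Type*} [Fintype V] (F : Q → V → ℝ≥0) (hF : Continuous F)
    (hsum : ∀ x, ∑ v, F x v = 1) :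
    ∃ F' : Q → V → ℝ≥0, Continuous F' ∧ (∀ x, ∑ v, F' x v = 1) ∧
      (∀ x, wsupp (F' x) ⊆ wsupp (F x)) ∧ (∀ x, (wsupp (F' x)).card ≤ d + 1) ∧
      ∀ x, (wsupp (F x)).card ≤ d + 1 → F' x = F x := by
  classical
  rcases isEmpty_or_nonempty V with hV | hV
  · exact ⟨F, hF, hsum, fun _ => Finset.Subset.rfl,
      fun x => by simp [Finset.eq_empty_of_isEmpty], fun _ _ => rfl⟩
  obtain ⟨N, ι, hc, hi, hthin⟩ := hQ
  -- With the `(d + 2)`-element sets forbidden, trimming leaves at most `d + 1` positive weights. It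
  -- is defined unless `d + 2` weights tie for the maximum; the perturbation below excludes such
  -- ties.
  let κ := {S : Finset V // S.card = d + 2}
  let S : κ → Finset V := Subtype.val
  have hS : ∀ i, (S i).Nonempty := fun i => Finset.card_pos.1 (by have := i.2; simp only [S]; omega)
  have hNpos : (0 : ℝ) < Fintype.card V := by exact_mod_cast Fintype.card_pos
  -- Some weight is at least `1 / |V| = 8c`. Multipliers in `[3/4, 5/4]` keep the maximum at least
  -- `6c`, so every weight tied for it was at least `4c` beforehand.
  set c : ℝ := 1 / (8 * Fintype.card V) with hcdef
  have hcpos : 0 < c := by positivity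
  let h : Q → V → ℝ := fun x v => max (F x v : ℝ) c
  have hFr : ∀ v, Continuous fun x => (F x v : ℝ) := fun v =>
    NNReal.continuous_coe.comp ((continuous_apply v).comp hF)
  have hhc : ∀ v, Continuous fun x => h x v := fun v => (hFr v).max continuous_const
  have hch : ∀ x v, c ≤ h x v := fun x v => le_max_right _ _
  choose H hH hHh using fun v => exists_contDiff_approx ι hc hi (fun x => h x v) (hhc v)
    (show 0 < c / 8 by positivity)
  obtain ⟨t, ht, hgen⟩ := exists_small_generic_translation hthin (fun y v => H v y)
    (contDiff_pi.2 hH) (show 0 < c / 8 by positivity)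
  let r : Q → V → ℝ := fun x v => (H v (ι x) + t v) / h x v
  have hr : ∀ x v, |r x v - 1| ≤ 1 / 4 := by
    intro x v
    have h0 : 0 < h x v := hcpos.trans_le (hch x v)
    have : r x v - 1 = (H v (ι x) - h x v + t v) / h x v := by
      simp only [r]; field_simp; ring
    rw [this, abs_div, abs_of_pos h0, div_le_iff₀ h0]
    have h1 := hHh v x
    have h2 := ht v
    have h3 := abs_add_le (H v (ι x) - h x v) (t v)
    have h4 := hch x v
    linarith
  have hrc : ∀ v, Continuous fun x => r x v := fun v =>
    ((((hH v).continuous.comp hc).add continuous_const).div (hhc v)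
      fun x => (hcpos.trans_le (hch x v)).ne')
  let θ : Q → ℝ := fun x => threshold S hS (F x)
  have hθc : Continuous θ := NNReal.continuous_coe.comp ((continuous_threshold S hS).comp hF)
  have hθ0 : ∀ x, 0 ≤ θ x := fun x => NNReal.coe_nonneg _
  -- The perturbation is switched off where the threshold vanishes, in particular where `F` already
  -- lies in the `d`-skeleton, and is fully on once the threshold reaches `2c`.
  let u : Q → ℝ := fun x => min 1 (θ x / (2 * c))
  have hu0 : ∀ x, 0 ≤ u x := fun x => le_min zero_le_one (div_nonneg (hθ0 x) (by positivity))
  have hu1 : ∀ x, u x ≤ 1 := fun x => min_le_left _ _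
  have huc : Continuous u := continuous_const.min (hθc.div_const _)
  let m : Q → V → ℝ := fun x v => 1 + u x * (r x v - 1)
  have hm : ∀ x v, |m x v - 1| ≤ 1 / 4 := by
    intro x v
    simp only [m, add_sub_cancel_left, abs_mul, abs_of_nonneg (hu0 x)]
    calc u x * |r x v - 1| ≤ 1 * (1 / 4) :=
          mul_le_mul (hu1 x) (hr x v) (abs_nonneg _) zero_le_one
      _ = 1 / 4 := one_mul _
  have hm1 : ∀ x v, 3 / 4 ≤ m x v := fun x v => by linarith [(abs_le.1 (hm x v)).1]
  have hm2 : ∀ x v, m x v ≤ 5 / 4 := fun x v => by linarith [(abs_le.1 (hm x v)).2]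
  have hmc : ∀ v, Continuous fun x => m x v := fun v =>
    continuous_const.add (huc.mul ((hrc v).sub continuous_const))
  let ψ : Q → V → ℝ≥0 := fun x v => F x v * Real.toNNReal (m x v)
  have hψc : Continuous ψ := continuous_pi fun v =>
    ((continuous_apply v).comp hF).mul (continuous_real_toNNReal.comp (hmc v))
  have hψr : ∀ x v, (ψ x v : ℝ) = F x v * m x v := fun x v => by
    simp only [ψ, NNReal.coe_mul]
    rw [Real.coe_toNNReal _ (by linarith [hm1 x v])]
  have hmain : ∀ x, ∃ v, threshold S hS (ψ x) < ψ x v := by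
    intro x
    by_contra! hcon
    obtain ⟨v₁, -, hv₁⟩ := Finset.exists_max_image Finset.univ (fun v => ψ x v)
      Finset.univ_nonempty
    obtain ⟨v₂, hv₂⟩ : ∃ v, 8 * c ≤ F x v := by
      by_contra! hlt
      have h1 : ∑ v, (F x v : ℝ) < ∑ _v : V, 8 * c :=
        Finset.sum_lt_sum_of_nonempty Finset.univ_nonempty fun v _ => hlt v
      have h2 : ∑ v, (F x v : ℝ) = 1 := by exact_mod_cast hsum x
      rw [h2, Finset.sum_const, Finset.card_univ, nsmul_eq_mul, hcdef] at h1
      have : (Fintype.card V : ℝ) * (8 * (1 / (8 * Fintype.card V))) = 1 := by field_simp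
      linarith
    have hM : 6 * c ≤ ψ x v₁ := by
      have h1 : (ψ x v₂ : ℝ) ≤ ψ x v₁ := by exact_mod_cast hv₁ v₂ (Finset.mem_univ _)
      rw [hψr x v₂] at h1
      have := hm1 x v₂
      nlinarith
    have hpos : 0 < ψ x v₁ := by
      have : (0 : ℝ) < ψ x v₁ := by linarith
      exact_mod_cast this
    obtain ⟨i, hi⟩ := exists_le_of_le_threshold S hS (ψ x) hpos (hcon v₁)
    have heq : ∀ v ∈ S i, ψ x v = ψ x v₁ := fun v hv =>
      le_antisymm (hv₁ v (Finset.mem_univ _)) (hi v hv)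
    have hFbig : ∀ v ∈ S i, 4 * c ≤ F x v := by
      intro v hv
      have h1 : (ψ x v : ℝ) = ψ x v₁ := by exact_mod_cast heq v hv
      rw [hψr] at h1
      have h2 := hm2 x v
      have h3 : (0 : ℝ) ≤ F x v := NNReal.coe_nonneg _
      nlinarith
    have hθ : 4 * c ≤ θ x := by
      have := le_threshold S hS (F x) i (Real.toNNReal (4 * c)) fun v hv =>
        Real.toNNReal_le_iff_le_coe.2 (hFbig v hv)
      exact Real.toNNReal_le_iff_le_coe.1 this
    have hu : u x = 1 := by
      refine min_eq_left ?_
      rw [le_div_iff₀ (by positivity)]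
      linarith
    -- On the tied coordinates `h = F` and `u = 1`, so the perturbed weight is exactly `H + t`, and
    -- the tie contradicts the choice of `t`.
    refine hgen (ι x) (mem_range_self x) (S i) i.2 (ψ x v₁) fun v hv => ?_
    have h1 : (ψ x v : ℝ) = ψ x v₁ := by exact_mod_cast heq v hv
    have hFh : h x v = F x v := max_eq_left (by linarith [hFbig v hv])
    have hFpos : (0 : ℝ) < F x v := by linarith [hFbig v hv]
    rw [← h1, hψr]
    simp only [m, hu, r, hFh]
    field_simp
    ring
  refine ⟨fun x => trim S hS (ψ x), ?_, fun x => sum_trim S hS _ (hmain x), fun x => ?_, fun x => ?_,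
    fun x hx => ?_⟩
  · exact continuous_iff_continuousAt.2 fun x =>
      (continuousAt_trim S hS _ (hmain x)).comp (f := ψ) hψc.continuousAt
  · refine (wsupp_trim_subset S hS _).trans fun v hv => ?_
    rw [mem_wsupp] at hv ⊢
    exact left_ne_zero_of_mul hv
  · by_contra! hcard
    obtain ⟨T, hT, hTc⟩ := Finset.exists_subset_card_eq (show d + 2 ≤ _ from hcard)
    exact not_subset_wsupp_trim S hS (ψ x) ⟨T, hTc⟩ hT
  · have hnot : ∀ i, ¬ S i ⊆ wsupp (F x) := fun i hi => by
      have h1 := Finset.card_le_card hi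
      have h2 : (S i).card = d + 2 := i.2
      omega
    have hθ : θ x = 0 := by
      simp only [θ]
      rw [threshold_eq_zero S hS _ hnot]
      rfl
    have hψ : ψ x = F x := by
      funext v
      simp [ψ, m, u, hθ]
    change trim S hS (ψ x) = F x
    rw [hψ]
    exact trim_eq_self S hS _ (hsum x) hnot

/-! ### Finite complexes as absolute extensors -/

/-- The geometric realization of an abstract simplicial complex, in barycentric coordinates. -/
abbrev Realization {V : Type*} [Fintype V] (K : Set (Finset V)) : Type _ :=
  {lam : V → ℝ≥0 // ∑ v, lam v = 1 ∧ wsupp lam ∈ K}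

theorem wsupp_nonempty {V : Type*} [Fintype V] {lam : V → ℝ≥0} (h : ∑ v, lam v = 1) :
    (wsupp lam).Nonempty := by
  by_contra hne
  rw [Finset.not_nonempty_iff_eq_empty] at hne
  have : ∀ v, lam v = 0 := fun v => by
    by_contra hv
    exact Finset.notMem_empty v (hne ▸ mem_wsupp.2 hv)
  simp [this] at h

/-- Faces are closed under passing to nonempty subsets. -/
def IsDownClosed {V : Type*} (K : Set (Finset V)) : Prop :=
  ∀ s ∈ K, ∀ t ⊆ s, t.Nonempty → t ∈ K

/-- Being supported inside a given face is a closed condition, unlike having exactly that support.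
Closure of the complex under subsets allows the former to replace the latter in a finite union over
faces. -/
theorem Realization.compactSpace {V : Type*} [Fintype V] {K : Set (Finset V)}
    (hK : IsDownClosed K) : CompactSpace (Realization K) := by
  refine isCompact_iff_compactSpace.1
    (?_ : IsCompact {lam : V → ℝ≥0 | ∑ v, lam v = 1 ∧ wsupp lam ∈ K})
  have h1 : {lam : V → ℝ≥0 | ∑ v, lam v = 1 ∧ wsupp lam ∈ K} =
      ⋃ s ∈ K, {lam : V → ℝ≥0 | ∑ v, lam v = 1 ∧ ∀ v, v ∉ s → lam v = 0} := by
    ext lam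
    simp only [mem_ofPred_eq, mem_iUnion, exists_prop]
    constructor
    · rintro ⟨h, hs⟩
      exact ⟨_, hs, h, fun v hv => by simpa using hv⟩
    · rintro ⟨s, hs, h, h0⟩
      refine ⟨h, hK s hs _ (fun v hv => ?_) (wsupp_nonempty h)⟩
      by_contra hvs
      exact mem_wsupp.1 hv (h0 v hvs)
  have hclosed : IsClosed {lam : V → ℝ≥0 | ∑ v, lam v = 1 ∧ wsupp lam ∈ K} := by
    rw [h1]
    refine K.toFinite.isClosed_biUnion fun s _ => ?_
    have h2 : {lam : V → ℝ≥0 | ∑ v, lam v = 1 ∧ ∀ v, v ∉ s → lam v = 0} =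
        {lam | ∑ v, lam v = 1} ∩ ⋂ v, ⋂ _ : v ∉ s, {lam | lam v = 0} := by
      ext lam
      simp
    rw [h2]
    refine IsClosed.inter (isClosed_eq (by fun_prop) continuous_const) ?_
    exact isClosed_iInter fun v => isClosed_iInter fun _ => isClosed_eq (by fun_prop)
      continuous_const
  refine (isCompact_Icc (a := (0 : V → ℝ≥0)) (b := 1)).of_isClosed_subset hclosed ?_
  rintro lam ⟨h, -⟩
  refine ⟨fun v => zero_le, fun v => ?_⟩
  rw [Pi.one_apply, ← h]
  exact Finset.single_le_sum (f := lam) (fun _ _ => zero_le) (Finset.mem_univ v)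

/-- A finite simplicial complex is an absolute neighbourhood extensor. -/
theorem Realization.exists_neighborhood_extension {V : Type*} [Fintype V] {K : Set (Finset V)}
    (hK : IsDownClosed K) {X : Type*} [TopologicalSpace X] [NormalSpace X] {A : Set X}
    (hA : IsClosed A) (f : C(A, Realization K)) :
    ∃ U : Set X, IsOpen U ∧ ∃ hAU : A ⊆ U, ∃ g : C(U, Realization K),
      ∀ x : A, g ⟨x, hAU x.2⟩ = f x := by
  classical
  -- Here the forbidden sets are the nonempty nonfaces. The coordinates extend by Tietze as
  -- nonnegative functions, and trimming returns them to the complex on the open set where some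
  -- coordinate exceeds the threshold.
  let κ := {S : Finset V // S.Nonempty ∧ S ∉ K}
  let S : κ → Finset V := Subtype.val
  have hS : ∀ i, (S i).Nonempty := fun i => i.2.1
  have hnot : ∀ (lam : Realization K) i, ¬ S i ⊆ wsupp lam.1 := fun lam i hi =>
    i.2.2 (hK _ lam.2.2 _ hi i.2.1)
  obtain ⟨ψ, hψ⟩ := ContinuousMap.exists_restrict_eq hA
    ((⟨Subtype.val, continuous_subtype_val⟩ : C(Realization K, V → ℝ≥0)).comp f)
  have hψA : ∀ x : A, ψ x = (f x).1 := fun x => DFunLike.congr_fun hψ x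
  let U : Set X := {x | ∃ v, threshold S hS (ψ x) < ψ x v}
  have hU : IsOpen U := by
    simp only [U, ofPred_exists]
    refine isOpen_iUnion fun v => isOpen_lt ?_ ?_
    · exact (continuous_threshold S hS).comp ψ.continuous
    · exact (continuous_apply v).comp ψ.continuous
  have hAU : A ⊆ U := by
    intro x hx
    obtain ⟨v, hv⟩ := wsupp_nonempty (f ⟨x, hx⟩).2.1
    refine ⟨v, ?_⟩
    rw [hψA ⟨x, hx⟩, threshold_eq_zero S hS _ (hnot _)]
    exact pos_iff_ne_zero.2 (mem_wsupp.1 hv)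
  refine ⟨U, hU, hAU, ⟨fun x => ⟨trim S hS (ψ x), sum_trim S hS _ x.2, ?_⟩, ?_⟩, fun x => ?_⟩
  · by_contra hmem
    exact not_subset_wsupp_trim S hS (ψ x) ⟨_, wsupp_nonempty (sum_trim S hS _ x.2), hmem⟩
      Finset.Subset.rfl
  · refine Continuous.subtype_mk ?_ _
    refine continuous_iff_continuousAt.2 fun x => ?_
    exact (continuousAt_trim S hS _ x.2).comp (f := fun x : U => ψ x)
      (ψ.continuous.comp continuous_subtype_val).continuousAt
  · refine Subtype.ext ?_
    change trim S hS (ψ x) = (f x).1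
    rw [hψA x]
    exact trim_eq_self S hS _ (f x).2.1 (hnot _)

/-- A contractible absolute neighbourhood extensor is an absolute extensor. -/
theorem TietzeExtension.of_contractible.{u, v} {Y : Type v} [TopologicalSpace Y]
    [ContractibleSpace Y]
    (hY : ∀ (X : Type u) [TopologicalSpace X] [NormalSpace X] (A : Set X), IsClosed A →
      ∀ f : C(A, Y), ∃ U : Set X, IsOpen U ∧ ∃ hAU : A ⊆ U, ∃ g : C(U, Y),
        ∀ x : A, g ⟨x, hAU x.2⟩ = f x) :
    TietzeExtension.{u, v} Y := by
  classical
  refine ⟨fun {X} _ _ A hA f => ?_⟩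
  obtain ⟨U, hU, hAU, g, hg⟩ := hY X A hA f
  obtain ⟨y₀, ⟨H⟩⟩ := id_nullhomotopic Y
  obtain ⟨W, hW, hAW, hWU⟩ := normal_exists_closure_subset hA hU hAU
  obtain ⟨u, hu0, hu1, hu⟩ := exists_continuous_zero_one_of_isClosed hA hW.isClosed_compl
    (disjoint_compl_right_iff_subset.2 hAW)
  -- The local extension is dragged along a contraction to `y₀`, with time `0` on `A` and time `1`
  -- off `W`; this permits the constant value `y₀` outside `U`.
  let Φ : X → Y := fun x => if hx : x ∈ U then H (⟨u x, hu x⟩, g ⟨x, hx⟩) else y₀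
  have hΦ : Continuous Φ := by
    rw [continuous_iff_continuousAt]
    intro x
    by_cases hx : x ∈ U
    · have : ContinuousOn Φ U := by
        rw [continuousOn_iff_continuous_domRestrict]
        have : U.domRestrict Φ = fun x : U => H (⟨u x, hu x⟩, g x) := by
          funext x
          simp [Φ, Set.domRestrict]
        rw [this]
        fun_prop
      exact this.continuousAt (hU.mem_nhds hx)
    · have hx' : x ∈ (closure W)ᶜ := fun h => hx (hWU h)
      refine (continuousAt_const (y := y₀)).congr ?_
      filter_upwards [isClosed_closure.isOpen_compl.mem_nhds hx'] with z hz
      have hz1 : u z = 1 := hu1 (fun h => hz (subset_closure h))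
      by_cases hzU : z ∈ U
      · simp only [Φ, hzU, dif_pos]
        have : (⟨u z, hu z⟩ : unitInterval) = 1 := Subtype.ext hz1
        rw [this]
        simp
      · simp [Φ, hzU]
  refine ⟨⟨Φ, hΦ⟩, ?_⟩
  ext x
  have hx0 : (⟨u x, hu x⟩ : unitInterval) = 0 := Subtype.ext (hu0 x.2)
  change Φ x = f x
  simp only [Φ, hAU x.2, dif_pos, hx0, ← hg x]
  simp

theorem Realization.tietzeExtension {V : Type*} [Fintype V] {K : Set (Finset V)}
    (hK : IsDownClosed K) [ContractibleSpace (Realization K)] : TietzeExtension (Realization K) :=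
  TietzeExtension.of_contractible fun _ _ _ _ hA f =>
    Realization.exists_neighborhood_extension hK hA f

/-! ### Barycentric coordinates on a geometric complex -/

section Barycentric

variable {N : ℕ} (J : Geometry.SimplicialComplex ℝ (EuclideanSpace ℝ (Fin N)))
  (W : Finset (EuclideanSpace ℝ (Fin N)))

/-- The faces of a geometric complex, as sets of elements of a finite set of points. -/
def absFaces : Set (Finset W) := {s | s.map (Function.Embedding.subtype _) ∈ J.faces}

theorem isDownClosed_absFaces : IsDownClosed (absFaces J W) := fun _ hs _ hts hne =>
  J.down_closed hs (Finset.map_subset_map.2 hts) (hne.map)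

/-- The point with given barycentric coordinates. -/
noncomputable def baryPoint (lam : W → ℝ≥0) : EuclideanSpace ℝ (Fin N) :=
  ∑ v, (lam v : ℝ) • (v : EuclideanSpace ℝ (Fin N))

theorem continuous_baryPoint : Continuous (baryPoint W) := by
  unfold baryPoint
  fun_prop

variable {J W}

theorem baryPoint_mem_convexHull {lam : W → ℝ≥0} (hsum : ∑ v, lam v = 1) {s : Finset W}
    (hs : wsupp lam ⊆ s) :
    baryPoint W lam ∈ convexHull ℝ
      (s.map (Function.Embedding.subtype _) : Set (EuclideanSpace ℝ (Fin N))) := by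
  have h0 : ∀ v ∉ s, lam v = 0 := fun v hv => by
    by_contra h
    exact hv (hs (mem_wsupp.2 h))
  have h1 : baryPoint W lam = ∑ v ∈ s, (lam v : ℝ) • (v : EuclideanSpace ℝ (Fin N)) :=
    (Finset.sum_subset (Finset.subset_univ s) fun v _ hv => by simp [h0 v hv]).symm
  rw [h1]
  refine (convex_convexHull ℝ _).sum_mem (fun _ _ => NNReal.coe_nonneg _) ?_ fun v hv => ?_
  · have h2 : ∑ v ∈ s, lam v = 1 := by
      rw [← hsum]
      exact Finset.sum_subset (Finset.subset_univ s) fun v _ hv => h0 v hv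
    exact_mod_cast h2
  · refine subset_convexHull ℝ _ ?_
    simp [hv]

theorem exists_baryPoint_eq {t : Finset (EuclideanSpace ℝ (Fin N))} (ht : t ⊆ W)
    {x : EuclideanSpace ℝ (Fin N)}
    (hx : x ∈ convexHull ℝ (t : Set (EuclideanSpace ℝ (Fin N)))) :
    ∃ lam : W → ℝ≥0, ∑ v, lam v = 1 ∧ (∀ v ∈ wsupp lam, (v : EuclideanSpace ℝ (Fin N)) ∈ t) ∧
      baryPoint W lam = x := by
  classical
  obtain ⟨w, hw0, hw1, hwx⟩ := Finset.mem_convexHull'.1 hx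
  let lam : W → ℝ≥0 := fun v => if (v : EuclideanSpace ℝ (Fin N)) ∈ t then (w v).toNNReal else 0
  have hlam : ∀ v : W, (lam v : ℝ) = if (v : EuclideanSpace ℝ (Fin N)) ∈ t then w v else 0 := by
    intro v
    by_cases hv : (v : EuclideanSpace ℝ (Fin N)) ∈ t
    · simp [lam, hv, hw0 _ hv]
    · simp [lam, hv]
  refine ⟨lam, ?_, fun v hv => ?_, ?_⟩
  · have : ∑ v, (lam v : ℝ) = 1 := by
      simp only [hlam]
      rw [Finset.sum_coe_sort W (fun v => if v ∈ t then w v else 0), Finset.sum_ite_mem,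
        Finset.inter_eq_right.2 ht, hw1]
    exact_mod_cast this
  · by_contra h
    exact mem_wsupp.1 hv (by simp [lam, h])
  · unfold baryPoint
    simp only [hlam]
    rw [Finset.sum_coe_sort W (fun v => (if v ∈ t then w v else 0) • v)]
    simp only [ite_smul, zero_smul]
    rw [Finset.sum_ite_mem, Finset.inter_eq_right.2 ht, hwx]

theorem baryPoint_injOn_face {s : Finset W} (hs : s ∈ absFaces J W) {lam mu : W → ℝ≥0}
    (hl : ∑ v, lam v = 1) (hm : ∑ v, mu v = 1) (hls : wsupp lam ⊆ s) (hms : wsupp mu ⊆ s)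
    (h : baryPoint W lam = baryPoint W mu) : lam = mu := by
  classical
  have hind := J.indep hs
  rw [affineIndependent_iff] at hind
  have hl0 : ∀ v ∉ s, lam v = 0 := fun v hv => by
    by_contra h
    exact hv (hls (mem_wsupp.2 h))
  have hm0 : ∀ v ∉ s, mu v = 0 := fun v hv => by
    by_contra h
    exact hv (hms (mem_wsupp.2 h))
  let e : s ↪ {x // x ∈ s.map (Function.Embedding.subtype (· ∈ W))} :=
    ⟨fun v => ⟨v.1.1, Finset.mem_map_of_mem (Function.Embedding.subtype (· ∈ W)) v.2⟩,
      fun a b hab => by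
        have := congrArg Subtype.val hab
        exact Subtype.ext (Subtype.ext this)⟩
  let w : {x // x ∈ s.map (Function.Embedding.subtype (· ∈ W))} → ℝ := fun x =>
    if hx : x.1 ∈ W then (lam ⟨x.1, hx⟩ : ℝ) - mu ⟨x.1, hx⟩ else 0
  have hwe : ∀ v, w (e v) = (lam v.1 : ℝ) - mu v.1 := fun v => dif_pos v.1.2
  have hsum : ∑ x ∈ Finset.univ.map e, w x = 0 := by
    rw [Finset.sum_map]
    simp only [hwe]
    rw [Finset.sum_coe_sort s (fun v => (lam v : ℝ) - mu v)]
    rw [Finset.sum_subset (Finset.subset_univ s) fun v _ hv => by simp [hl0 v hv, hm0 v hv]]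
    rw [Finset.sum_sub_distrib]
    have h1 : ∑ v, (lam v : ℝ) = 1 := by exact_mod_cast hl
    have h2 : ∑ v, (mu v : ℝ) = 1 := by exact_mod_cast hm
    rw [h1, h2, sub_self]
  have hcomb : ∑ x ∈ Finset.univ.map e, w x • (x : EuclideanSpace ℝ (Fin N)) = 0 := by
    rw [Finset.sum_map]
    simp only [hwe]
    change ∑ v : s, ((lam v.1 : ℝ) - mu v.1) • (v.1 : EuclideanSpace ℝ (Fin N)) = 0
    rw [Finset.sum_coe_sort s (fun v => ((lam v : ℝ) - mu v) • (v : EuclideanSpace ℝ (Fin N)))]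
    rw [Finset.sum_subset (Finset.subset_univ s) fun v _ hv => by simp [hl0 v hv, hm0 v hv]]
    simp only [sub_smul]
    rw [Finset.sum_sub_distrib, sub_eq_zero]
    exact h
  funext v
  by_cases hv : v ∈ s
  · have := hind _ w hsum hcomb (e ⟨v, hv⟩) (Finset.mem_map_of_mem e (Finset.mem_univ _))
    rw [hwe] at this
    exact_mod_cast sub_eq_zero.1 this
  · rw [hl0 v hv, hm0 v hv]

/-- The two carriers meet inside the convex hull of their common vertices. Coordinates `nu` of the
point supported there agree with `lam` on one face and with `mu` on the other, by affine
independence on each. -/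
theorem baryPoint_injOn (hW : ∀ s ∈ J.faces, s ⊆ W) {lam mu : W → ℝ≥0} (hl : ∑ v, lam v = 1)
    (hm : ∑ v, mu v = 1) (hls : wsupp lam ∈ absFaces J W) (hms : wsupp mu ∈ absFaces J W)
    (h : baryPoint W lam = baryPoint W mu) : lam = mu := by
  classical
  have h1 := baryPoint_mem_convexHull hl Finset.Subset.rfl
  have h2 := baryPoint_mem_convexHull hm Finset.Subset.rfl
  rw [← h] at h2
  have h3 := J.inter_subset_convexHull hls hms ⟨h1, h2⟩
  rw [← Finset.coe_inter] at h3
  obtain ⟨nu, hn, hns, hnx⟩ := exists_baryPoint_eq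
    (Finset.inter_subset_left.trans (hW _ hls)) h3
  have hns1 : wsupp nu ⊆ wsupp lam := fun v hv => by
    have := (Finset.mem_inter.1 (hns v hv)).1
    simpa using this
  have hns2 : wsupp nu ⊆ wsupp mu := fun v hv => by
    have := (Finset.mem_inter.1 (hns v hv)).2
    simpa using this
  exact (baryPoint_injOn_face hls hl hn Finset.Subset.rfl hns1 hnx.symm).trans
    (baryPoint_injOn_face hms hm hn Finset.Subset.rfl hns2 (h.symm.trans hnx.symm)).symm

theorem baryPoint_mem_space (lam : Realization (absFaces J W)) : baryPoint W lam.1 ∈ J.space :=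
  J.convexHull_subset_space lam.2.2 (baryPoint_mem_convexHull lam.2.1 Finset.Subset.rfl)

theorem exists_realization_eq (hW : ∀ s ∈ J.faces, s ⊆ W)
    {t : Finset (EuclideanSpace ℝ (Fin N))} (ht : t ∈ J.faces) {x : EuclideanSpace ℝ (Fin N)}
    (hx : x ∈ convexHull ℝ (t : Set (EuclideanSpace ℝ (Fin N)))) :
    ∃ lam : Realization (absFaces J W), baryPoint W lam.1 = x ∧
      (wsupp lam.1).map (Function.Embedding.subtype _) ⊆ t := by
  obtain ⟨lam, h1, h2, h3⟩ := exists_baryPoint_eq (hW t ht) hx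
  have hsub : (wsupp lam).map (Function.Embedding.subtype _) ⊆ t := by
    intro y hy
    obtain ⟨v, hv, rfl⟩ := Finset.mem_map.1 hy
    exact h2 v hv
  exact ⟨⟨lam, h1, J.down_closed ht hsub (wsupp_nonempty h1).map⟩, h3, hsub⟩

/-- The underlying space of a finite geometric complex is homeomorphic, by barycentric
coordinates, to the realization of its abstract complex. -/
noncomputable def realizationHomeo (hW : ∀ s ∈ J.faces, s ⊆ W) :
    Realization (absFaces J W) ≃ₜ J.space :=
  haveI : CompactSpace (Realization (absFaces J W)) :=
    Realization.compactSpace (isDownClosed_absFaces J W)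
  Continuous.homeoOfEquivCompactToT2
    (f := Equiv.ofBijective (fun lam => (⟨baryPoint W lam.1, baryPoint_mem_space lam⟩ : J.space))
      ⟨fun lam mu h => Subtype.ext (baryPoint_injOn hW lam.2.1 mu.2.1 lam.2.2 mu.2.2
          (congrArg Subtype.val h)),
        fun x => by
          obtain ⟨t, ht, hx⟩ := Geometry.SimplicialComplex.mem_space_iff.1 x.2
          obtain ⟨lam, hlam, -⟩ := exists_realization_eq hW ht hx
          exact ⟨lam, Subtype.ext hlam⟩⟩)
    (((continuous_baryPoint W).comp continuous_subtype_val).subtype_mk _)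

theorem coe_realizationHomeo (hW : ∀ s ∈ J.faces, s ⊆ W) (lam : Realization (absFaces J W)) :
    (realizationHomeo hW lam : EuclideanSpace ℝ (Fin N)) = baryPoint W lam.1 := rfl

end Barycentric

/-! ### Star-shaped sets and cells -/

section StarBody

variable {F : Type*} [NormedAddCommGroup F] [NormedSpace ℝ F]

/-- The gauge of a set that is star-shaped about every point of a ball is Lipschitz. -/
theorem gauge_le_gauge_add_of_star {B : Set F} {r : ℝ} (hr : 0 < r) (hB0 : Metric.closedBall 0 r ⊆ B)
    (hstar : ∀ x ∈ B, ∀ b, ‖b‖ ≤ r → ∀ t : ℝ, 0 ≤ t → t ≤ 1 → t • x + (1 - t) • b ∈ B) (x y : F) :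
    gauge B x ≤ gauge B y + r⁻¹ * dist x y := by
  rcases eq_or_ne x y with rfl | hne
  · simp
  have habs : Absorbent ℝ B :=
    absorbent_nhds_zero (Filter.mem_of_superset (Metric.closedBall_mem_nhds 0 hr) hB0)
  have hd : 0 < dist x y := dist_pos.2 hne
  refine le_of_forall_pos_lt_add fun η hη => ?_
  obtain ⟨b, hb, hbη, z, hz, rfl⟩ := exists_lt_of_gauge_lt habs (lt_add_of_pos_right (gauge B y) hη)
  set y := b • z
  set c := r⁻¹ * dist x y with hc
  have hcpos : 0 < c := by positivity
  refine (gauge_le_of_mem (a := b + c) (by positivity) ?_).trans_lt (by linarith)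
  -- `x = b • z + (x - y)` is `b + c` times a convex combination of `z ∈ B` and the vector `c⁻¹ • (x
  -- - y)` of norm `r`.
  refine ⟨(b / (b + c)) • z + (1 - b / (b + c)) • (c⁻¹ • (x - y)), ?_, ?_⟩
  · refine hstar z hz _ ?_ _ (by positivity) ?_
    · rw [norm_smul, norm_inv, Real.norm_of_nonneg hcpos.le, ← dist_eq_norm, hc]
      have : (r⁻¹ * dist x y)⁻¹ * dist x y = r := by
        rw [mul_inv, inv_inv, mul_assoc, inv_mul_cancel₀ (show dist x y ≠ 0 from hd.ne'), mul_one]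
      exact this.le
    · rw [div_le_one (by positivity)]
      linarith
  · have h1 : (b + c) * (b / (b + c)) = b := by field_simp
    have h2 : (b + c) * (1 - b / (b + c)) * c⁻¹ = 1 := by field_simp; ring
    change (b + c) • _ = x
    rw [smul_add, smul_smul, smul_smul, smul_smul, h1, h2, one_smul]
    simp [y]

/-- A compact set that is star-shaped about every point of a ball is a cell. -/
theorem nonempty_homeomorph_closedBall_of_star {B : Set F} (hB : IsCompact B) (hne : B.Nonempty)
    {r : ℝ} (hr : 0 < r)
    (hstar : ∀ x ∈ B, ∀ b, ‖b‖ ≤ r → ∀ t : ℝ, 0 ≤ t → t ≤ 1 → t • x + (1 - t) • b ∈ B) :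
    Nonempty (B ≃ₜ Metric.closedBall (0 : F) 1) := by
  have hB0 : Metric.closedBall 0 r ⊆ B := by
    intro b hb
    obtain ⟨x, hx⟩ := hne
    simpa using hstar x hx b (by simpa using hb) 0 le_rfl zero_le_one
  have hnhds : B ∈ 𝓝 (0 : F) := Filter.mem_of_superset (Metric.closedBall_mem_nhds 0 hr) hB0
  have habs : Absorbent ℝ B := absorbent_nhds_zero hnhds
  have hbdd : Bornology.IsVonNBounded ℝ B := hB.isVonNBounded ℝ
  have hcont : Continuous (gauge B) := by
    have : LipschitzWith (Real.toNNReal r⁻¹) (gauge B) :=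
      LipschitzWith.of_le_add_mul _ fun x y => by
        rw [Real.coe_toNNReal _ (by positivity)]
        exact gauge_le_gauge_add_of_star hr hB0 hstar x y
    exact this.continuous
  have hpos : ∀ x : F, x ≠ 0 → 0 < gauge B x := fun x hx => (gauge_pos habs hbdd).2 hx
  have hmem : ∀ x : F, gauge B x ≤ 1 → x ∈ B := by
    intro x hx
    have h1 : ∀ t : ℝ, 1 < t → t⁻¹ • x ∈ B := by
      intro t ht
      obtain ⟨b, hb, hbt, z, hz, rfl⟩ := exists_lt_of_gauge_lt habs (hx.trans_lt ht)
      have h2 : t⁻¹ • b • z = (b / t) • z + (1 - b / t) • (0 : F) := by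
        rw [smul_smul, smul_zero, add_zero, div_eq_inv_mul]
      change t⁻¹ • b • z ∈ B
      rw [h2]
      refine hstar z hz 0 (by simpa using hr.le) _ (by positivity) ?_
      rw [div_le_one (by linarith)]
      exact hbt.le
    have h2 : Filter.Tendsto (fun t : ℝ => t⁻¹ • x) (𝓝[>] 1) (𝓝 ((1 : ℝ)⁻¹ • x)) :=
      ((tendsto_inv₀ one_ne_zero).mono_left inf_le_left).smul tendsto_const_nhds
    rw [inv_one, one_smul] at h2
    exact hB.isClosed.mem_of_tendsto h2
      (by filter_upwards [self_mem_nhdsWithin] with t ht using h1 t ht)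
  -- A radial rescaling that turns the gauge into the norm and hence takes `B` to the unit ball.
  let T : F → F := fun x => (gauge B x / ‖x‖) • x
  have hTnorm : ∀ x, ‖T x‖ = gauge B x := by
    intro x
    rcases eq_or_ne x 0 with rfl | hx
    · simp [T]
    · have : 0 < ‖x‖ := norm_pos_iff.2 hx
      simp only [T]
      rw [norm_smul, norm_div, norm_norm, Real.norm_of_nonneg (gauge_nonneg x)]
      field_simp
  have hTcont : Continuous T := by
    rw [continuous_iff_continuousAt]
    intro x
    rcases eq_or_ne x 0 with rfl | hx
    · have : Filter.Tendsto T (𝓝 0) (𝓝 0) := by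
        rw [tendsto_zero_iff_norm_tendsto_zero]
        simp only [hTnorm]
        simpa using hcont.tendsto 0
      simpa [ContinuousAt, T] using this
    · exact (hcont.continuousAt.div continuous_norm.continuousAt (norm_ne_zero_iff.2 hx)).smul
        continuousAt_id
  have hTinj : Function.Injective T := by
    intro x y hxy
    have hg : gauge B x = gauge B y := by rw [← hTnorm, ← hTnorm, hxy]
    rcases eq_or_ne x 0 with rfl | hx
    · rw [gauge_zero] at hg
      exact ((gauge_eq_zero habs hbdd).1 hg.symm).symm
    have hy : y ≠ 0 := by
      rintro rfl
      rw [gauge_zero] at hg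
      exact hx ((gauge_eq_zero habs hbdd).1 hg)
    have hxn : 0 < ‖x‖ := norm_pos_iff.2 hx
    have hyn : 0 < ‖y‖ := norm_pos_iff.2 hy
    have h1 : y = (‖y‖ / ‖x‖) • x := by
      have h2 : (‖y‖ / gauge B y) • T x = (‖y‖ / gauge B y) • T y := by rw [hxy]
      have hgy := hpos y hy
      simp only [T, smul_smul, hg] at h2
      have h3 : ‖y‖ / gauge B y * (gauge B y / ‖y‖) = 1 := by field_simp
      have h4 : ‖y‖ / gauge B y * (gauge B y / ‖x‖) = ‖y‖ / ‖x‖ := by field_simp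
      rw [h3, h4, one_smul] at h2
      exact h2.symm
    have h2 : gauge B y = (‖y‖ / ‖x‖) * gauge B x := by
      conv_lhs => rw [h1]
      rw [gauge_smul_of_nonneg (by positivity), smul_eq_mul]
    have h3 : ‖y‖ / ‖x‖ = 1 := by
      have := hpos x hx
      rw [← hg] at h2
      field_simp at h2 ⊢
      linarith
    rw [h1, h3, one_smul]
  have hTsurj : ∀ y : F, ‖y‖ ≤ 1 → ∃ x ∈ B, T x = y := by
    intro y hy
    rcases eq_or_ne y 0 with rfl | hy0
    · exact ⟨0, mem_of_mem_nhds hnhds, by simp [T]⟩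
    have hyn : 0 < ‖y‖ := norm_pos_iff.2 hy0
    have hgy := hpos y hy0
    have hg : gauge B ((‖y‖ / gauge B y) • y) = ‖y‖ := by
      rw [gauge_smul_of_nonneg (by positivity), smul_eq_mul]
      field_simp
    refine ⟨(‖y‖ / gauge B y) • y, hmem _ (hg.trans_le hy), ?_⟩
    simp only [T]
    rw [hg, norm_smul, norm_div, norm_norm, Real.norm_of_nonneg hgy.le, smul_smul]
    have : ‖y‖ / (‖y‖ / gauge B y * ‖y‖) * (‖y‖ / gauge B y) = 1 := by field_simp
    rw [this, one_smul]
  have : CompactSpace B := isCompact_iff_compactSpace.1 hB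
  let f : B → Metric.closedBall (0 : F) 1 := fun x =>
    ⟨T x, by rw [mem_closedBall_zero_iff, hTnorm]; exact gauge_le_one_of_mem x.2⟩
  have hf : Function.Bijective f := by
    refine ⟨fun x y hxy => Subtype.ext (hTinj (congrArg Subtype.val hxy)), fun y => ?_⟩
    obtain ⟨x, hx, hxy⟩ := hTsurj y (mem_closedBall_zero_iff.1 y.2)
    exact ⟨⟨x, hx⟩, Subtype.ext hxy⟩
  exact ⟨Continuous.homeoOfEquivCompactToT2 (f := Equiv.ofBijective f hf)
    ((hTcont.comp continuous_subtype_val).subtype_mk _)⟩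

/-- A compact star-shaped set has arbitrarily small neighbourhoods that are cells. -/
theorem exists_cell_nhd_of_starConvex [FiniteDimensional ℝ F] {S O : Set F} (hS : IsCompact S)
    (hstar : StarConvex ℝ 0 S) (h0 : (0 : F) ∈ S) (hO : IsOpen O) (hSO : S ⊆ O) :
    ∃ C ⊆ O, Nonempty (C ≃ₜ Metric.closedBall (0 : F) 1) ∧ S ⊆ interior C := by
  have : ProperSpace F := FiniteDimensional.proper ℝ F
  obtain ⟨r, hr, hrO⟩ := hS.exists_cthickening_subset_open hO hSO
  -- Fattening by the convex `r`-ball makes the set star-shaped about every point of that ball.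
  refine ⟨S + Metric.closedBall 0 r, ?_, ?_, ?_⟩
  · rintro _ ⟨s, hs, c, hc, rfl⟩
    refine hrO (Metric.mem_cthickening_of_dist_le _ s r S hs ?_)
    simpa [dist_eq_norm] using hc
  · refine nonempty_homeomorph_closedBall_of_star (hS.add (isCompact_closedBall 0 r))
      ⟨0, 0, h0, 0, by simpa using hr.le, by simp⟩ hr ?_
    rintro _ ⟨s, hs, c, hc, rfl⟩ b hb t ht0 ht1
    refine ⟨t • s, starConvex_zero_iff.1 hstar hs ht0 ht1, t • c + (1 - t) • b, ?_, ?_⟩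
    · have h1 : c ∈ Metric.closedBall (0 : F) r := hc
      have h2 : b ∈ Metric.closedBall (0 : F) r := by simpa using hb
      exact (convex_closedBall (0 : F) r) h1 h2 ht0 (by linarith) (by ring)
    · change t • s + (t • c + (1 - t) • b) = t • (s + c) + (1 - t) • b
      rw [smul_add, add_assoc]
  · refine (subset_interior_iff_isOpen.2 (Metric.isOpen_ball (x := (0 : F)) (ε := r)).add_left).trans'
      ?_ |>.trans (interior_mono (add_subset_add_left Metric.ball_subset_closedBall))
    intro s hs
    exact ⟨s, hs, 0, by simpa using hr, by simp⟩

end StarBody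

/-! ### Klee's trick and cell neighbourhoods -/

/-- Klee's trick: an embedded copy of a compact subset `S ⊆ F` in `E` can be moved to `0 × S` by a
homeomorphism of `E × F`. -/
theorem exists_homeomorph_prod_of_injective {E F : Type*} [NormedAddCommGroup E] [NormedSpace ℝ E]
    [FiniteDimensional ℝ E] [NormedAddCommGroup F] [NormedSpace ℝ F] [FiniteDimensional ℝ F]
    {S : Set F} (hS : IsCompact S) (e : S → E) (he : Continuous e) (hi : Function.Injective e) :
    ∃ H : E × F ≃ₜ E × F, ∀ s : S, H (e s, 0) = (0, (s : F)) := by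
  have : CompactSpace S := isCompact_iff_compactSpace.1 hS
  obtain ⟨α, hα⟩ := ContinuousMap.exists_extension' (he.isClosedEmbedding hi)
    (⟨Subtype.val, continuous_subtype_val⟩ : C(S, F))
  obtain ⟨β, hβ⟩ := ContinuousMap.exists_restrict_eq hS.isClosed (⟨e, he⟩ : C(S, E))
  have hα' : ∀ s, α (e s) = s := fun s => congrFun hα s
  have hβ' : ∀ s : S, β s = e s := fun s => DFunLike.congr_fun hβ s
  -- Two shears: `(e s, 0)` goes to `(e s, s)` by `α`, which extends the inverse of `e`, and then to
  -- `(0, s)` by `β`, which extends `e`.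
  let H₁ : E × F ≃ₜ E × F :=
    { toFun := fun p => (p.1, p.2 + α p.1)
      invFun := fun p => (p.1, p.2 - α p.1)
      left_inv := fun p => by simp
      right_inv := fun p => by simp }
  let H₂ : E × F ≃ₜ E × F :=
    { toFun := fun p => (p.1 - β p.2, p.2)
      invFun := fun p => (p.1 + β p.2, p.2)
      left_inv := fun p => by simp
      right_inv := fun p => by simp }
  refine ⟨H₁.trans H₂, fun s => ?_⟩
  simp [H₁, H₂, hα', hβ']

/-- A copy in `ℝ^m × 0 ⊆ ℝ^(m + k)` of a compact star-shaped subset of `ℝ^k` has arbitrarily small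
neighbourhoods that are cells. -/
theorem exists_isCell_nhd {m k : ℕ}
    (Φ : (EuclideanSpace ℝ (Fin m) × EuclideanSpace ℝ (Fin k)) ≃L[ℝ] EuclideanSpace ℝ (Fin (m + k)))
    {S : Set (EuclideanSpace ℝ (Fin k))} (hS : IsCompact S) (hstar : StarConvex ℝ 0 S)
    (h0 : (0 : EuclideanSpace ℝ (Fin k)) ∈ S) (e : S → EuclideanSpace ℝ (Fin m)) (he : Continuous e)
    (hi : Function.Injective e) {O : Set (EuclideanSpace ℝ (Fin (m + k)))} (hO : IsOpen O)
    (heO : ∀ s, Φ (e s, 0) ∈ O) :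
    ∃ C ⊆ O, IsCell C ∧ ∀ s, Φ (e s, 0) ∈ interior C := by
  obtain ⟨H, hH⟩ := exists_homeomorph_prod_of_injective hS e he hi
  let Θ : EuclideanSpace ℝ (Fin (m + k)) ≃ₜ EuclideanSpace ℝ (Fin (m + k)) :=
    Φ.toHomeomorph.symm.trans (H.trans Φ.toHomeomorph)
  have hΘ : ∀ s, Θ (Φ (e s, 0)) = Φ (0, (s : EuclideanSpace ℝ (Fin k))) := fun s => by
    have : Θ (Φ (e s, 0)) = Φ (H (Φ.symm (Φ (e s, 0)))) := rfl
    rw [this, Φ.symm_apply_apply, hH]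
  let lin : EuclideanSpace ℝ (Fin k) →L[ℝ] EuclideanSpace ℝ (Fin (m + k)) :=
    Φ.toContinuousLinearMap.comp (ContinuousLinearMap.inr ℝ _ _)
  have hlin : ∀ x, lin x = Φ (0, x) := fun x => rfl
  obtain ⟨C', hC'O, hC', hSC'⟩ := exists_cell_nhd_of_starConvex (S := lin '' S)
    (O := Θ.symm ⁻¹' O) (hS.image lin.continuous)
    (by
      rw [starConvex_zero_iff] at hstar ⊢
      rintro _ ⟨x, hx, rfl⟩ a ha0 ha1
      exact ⟨a • x, hstar hx ha0 ha1, by simp⟩)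
    ⟨0, h0, by simp⟩ (hO.preimage Θ.symm.continuous)
    (by
      rintro _ ⟨x, hx, rfl⟩
      rw [mem_preimage, hlin, ← hΘ ⟨x, hx⟩, Θ.symm_apply_apply]
      exact heO _)
  refine ⟨Θ ⁻¹' C', fun x hx => ?_, ?_, fun s => ?_⟩
  · have := hC'O hx
    simpa using this
  · obtain ⟨ψ⟩ := hC'
    exact ⟨(Θ.sets (s := Θ ⁻¹' C') (t := C') rfl).trans ψ⟩
  · rw [← Θ.preimage_interior, mem_preimage, hΘ]
    exact hSC' ⟨s, s.2, rfl⟩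

/-! ### Threads from compactness -/

theorem exists_partial_thread {M : ℕ → Type*} (g : ∀ i, M (i + 1) → M i) (d : ∀ i, M i) (l : ℕ)
    (a : M l) : ∃ s : ∀ j, M j, s l = a ∧ ∀ j < l, g j (s (j + 1)) = s j := by
  induction l with
  -- The coordinates above `l` carry no condition; `d` merely fills them.
  | zero => exact ⟨Function.update d 0 a, by simp, by simp⟩
  | succ l ih =>
    obtain ⟨s, hs, hsg⟩ := ih (g l a)
    refine ⟨Function.update s (l + 1) a, by simp, fun j hj => ?_⟩
    rcases Nat.lt_succ_iff_lt_or_eq.1 hj with h | rfl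
    · rw [Function.update_of_ne (by omega), Function.update_of_ne (by omega), hsg j h]
    · rw [Function.update_self, Function.update_of_ne (by omega), hs]

/-- In an inverse sequence of compact spaces, the partial threads below given points accumulate at
a thread. -/
theorem exists_limit_thread {M : ℕ → Type*} [∀ i, TopologicalSpace (M i)]
    [∀ i, CompactSpace (M i)] [∀ i, T2Space (M i)] (g : ∀ i, M (i + 1) → M i)
    (hg : ∀ i, Continuous (g i)) (a : ∀ l, M l) :
    ∃ (s : ℕ → ∀ j, M j) (U : Ultrafilter ℕ) (c : InvLimit g), (∀ l, s l l = a l) ∧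
      (∀ l, ∀ j < l, g j (s l (j + 1)) = s l j) ∧ (U : Filter ℕ) ≤ Filter.atTop ∧
      Filter.Tendsto s U (𝓝 c.1) := by
  choose s hs hsg using fun l => exists_partial_thread g a l (a l)
  let U : Ultrafilter ℕ := Filter.hyperfilter ℕ
  have hU : (U : Filter ℕ) ≤ Filter.atTop := by
    rw [← Nat.cofinite_eq_atTop]
    exact Filter.hyperfilter_le_cofinite
  obtain ⟨c, -, hc⟩ := isCompact_univ.ultrafilter_le_nhds (U.map s) (by simp)
  have hc' : Filter.Tendsto s U (𝓝 c) := hc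
  refine ⟨s, U, ⟨c, fun i => ?_⟩, hs, hsg, hU, hc'⟩
  have h1 : Filter.Tendsto (fun l => g i (s l (i + 1))) U (𝓝 (g i (c (i + 1)))) :=
    ((hg i).tendsto _).comp ((tendsto_pi_nhds.1 hc') (i + 1))
  have h2 : Filter.Tendsto (fun l => s l i) U (𝓝 (c i)) := (tendsto_pi_nhds.1 hc') i
  refine tendsto_nhds_unique (h1.congr' ?_) h2
  filter_upwards [hU (Filter.eventually_gt_atTop i)] with l hl using hsg l i hl

/-! ### Cellularity of limits of star-shaped compacta -/

section Tower

variable {m k : ℕ}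

/-- The data attached to one stage of a tower: a cell `C` which is a small neighbourhood of the
embedded stage, and a number `η` that bounds the admissible displacement of later stages. -/
structure IsGoodStage {Y : Type*} (J : EuclideanSpace ℝ (Fin m) → EuclideanSpace ℝ (Fin (m + k)))
    {S : ℕ → Set (EuclideanSpace ℝ (Fin k))} (p : ∀ j, Y → S j) (j : ℕ)
    (e : S j → EuclideanSpace ℝ (Fin m)) (C : Set (EuclideanSpace ℝ (Fin (m + k)))) (η : ℝ) :
    Prop where
  continuous : Continuous e
  isCell : IsCell C
  pos : 0 < η
  near : ∀ z ∈ C, ∃ s, dist z (J (e s)) < 1 / (j + 1)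
  mem_interior : ∀ v s, dist v (e s) ≤ 2 * η → J v ∈ interior C
  separating : ∀ y y', dist (e (p j y)) (e (p j y')) ≤ 4 * η →
    ∀ i ≤ j, dist (p i y) (p i y') < 1 / (j + 1)

variable {Y : Type*} [TopologicalSpace Y] [CompactSpace Y]
  {S : ℕ → Set (EuclideanSpace ℝ (Fin k))}

/-- Compactness: on the pairs at distance at least `r` in some stage `i ≤ j`, the distance of the
images under `e` has a positive minimum, since equality in stage `j` forces equality in all lower
stages. -/
theorem exists_separation_constant (p : ∀ j, Y → S j) (hp : ∀ j, Continuous (p j))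
    (h : ∀ j, S (j + 1) → S j) (hph : ∀ j y, h j (p (j + 1) y) = p j y) (j : ℕ)
    (e : S j → EuclideanSpace ℝ (Fin m)) (he : Continuous e) (hi : Function.Injective e) {r : ℝ}
    (hr : 0 < r) :
    ∃ η > 0, ∀ y y', dist (e (p j y)) (e (p j y')) ≤ 4 * η →
      ∀ i ≤ j, dist (p i y) (p i y') < r := by
  have hdown : ∀ y y', p j y = p j y' → ∀ i ≤ j, p i y = p i y' := by
    intro y y' hy i hij
    induction hij using Nat.decreasingInduction with
    | self => exact hy
    | of_succ i _ ih => rw [← hph i y, ← hph i y', ih]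
  let D : Set (Y × Y) := ⋃ i ∈ Iic j, {q | r ≤ dist (p i q.1) (p i q.2)}
  have hD : IsCompact D := by
    refine IsClosed.isCompact ((finite_Iic j).isClosed_biUnion fun i _ => ?_)
    have := hp i
    exact isClosed_le continuous_const (by fun_prop)
  have hmemD : ∀ y y', ∀ i ≤ j, r ≤ dist (p i y) (p i y') → (y, y') ∈ D := fun y y' i hij hle =>
    mem_biUnion (show i ∈ Iic j from hij) hle
  rcases D.eq_empty_or_nonempty with hDe | hDne
  · refine ⟨1, one_pos, fun y y' _ i hij => ?_⟩
    by_contra! hle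
    have := hmemD y y' i hij hle
    simp [hDe] at this
  · have := hp j
    obtain ⟨⟨a, b⟩, hab, hmin⟩ := hD.exists_isMinOn hDne
      (f := fun q : Y × Y => dist (e (p j q.1)) (e (p j q.2))) (by fun_prop)
    have hpos : 0 < dist (e (p j a)) (e (p j b)) := by
      rw [dist_pos]
      intro heq
      obtain ⟨i, hij, hle⟩ := mem_iUnion₂.1 hab
      have h1 : p i a = p i b := hdown a b (hi heq) i hij
      have h2 : r ≤ dist (p i a) (p i b) := hle
      rw [h1, dist_self] at h2
      linarith
    refine ⟨dist (e (p j a)) (e (p j b)) / 8, by positivity, fun y y' hy i hij => ?_⟩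
    by_contra! hle
    have h1 : dist (e (p j a)) (e (p j b)) ≤ dist (e (p j y)) (e (p j y')) :=
      isMinOn_iff.1 hmin (y, y') (hmemD y y' i hij hle)
    linarith

theorem exists_goodStage
    (Φ : (EuclideanSpace ℝ (Fin m) × EuclideanSpace ℝ (Fin k)) ≃L[ℝ] EuclideanSpace ℝ (Fin (m + k)))
    (hS : ∀ j, IsCompact (S j)) (hstar : ∀ j, StarConvex ℝ 0 (S j))
    (h0 : ∀ j, (0 : EuclideanSpace ℝ (Fin k)) ∈ S j)
    (p : ∀ j, Y → S j) (hp : ∀ j, Continuous (p j))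
    (h : ∀ j, S (j + 1) → S j) (hph : ∀ j y, h j (p (j + 1) y) = p j y) (j : ℕ)
    (e : S j → EuclideanSpace ℝ (Fin m)) (he : Continuous e) (hi : Function.Injective e)
    {O : Set (EuclideanSpace ℝ (Fin (m + k)))} (hO : IsOpen O) (heO : ∀ s, Φ (e s, 0) ∈ O)
    {b : ℝ} (hb : 0 < b) :
    ∃ C η, C ⊆ O ∧ η ≤ b ∧ IsGoodStage (fun v => Φ (v, 0)) p j e C η := by
  let J : EuclideanSpace ℝ (Fin m) → EuclideanSpace ℝ (Fin (m + k)) := fun v => Φ (v, 0)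
  have hJ : Continuous J := Φ.continuous.comp (by fun_prop)
  have hjpos : (0 : ℝ) < 1 / (j + 1) := by positivity
  let O' := O ∩ Metric.thickening (1 / ((j : ℝ) + 1)) (range fun s => J (e s))
  obtain ⟨C, hCO, hC, hCe⟩ := exists_isCell_nhd Φ (hS j) (hstar j) (h0 j) e he hi
    (O := O') (hO.inter Metric.isOpen_thickening)
    fun s => ⟨heO s, Metric.self_subset_thickening hjpos _ (mem_range_self s)⟩
  have : CompactSpace (S j) := isCompact_iff_compactSpace.1 (hS j)
  obtain ⟨r, hr, hrC⟩ := (isCompact_range he).exists_cthickening_subset_open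
    (isOpen_interior.preimage hJ) (by rintro _ ⟨s, rfl⟩; exact hCe s)
  obtain ⟨μ, hμ, hsep⟩ := exists_separation_constant p hp h hph j e he hi hjpos
  -- `r / 2` makes the `2η`-neighbourhood of the embedded stage lie in the interior of `C`; `μ`
  -- gives the separation at scale `4η`.
  refine ⟨C, min b (min (r / 2) μ), fun z hz => (hCO hz).1, min_le_left _ _, he, hC, by positivity,
    fun z hz => ?_, fun v s hvs => ?_, fun y y' hy => hsep y y' (hy.trans ?_)⟩
  · obtain ⟨_, ⟨s, rfl⟩, hs⟩ := Metric.mem_thickening_iff.1 (hCO hz).2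
    exact ⟨s, hs⟩
  · refine hrC (Metric.mem_cthickening_of_dist_le v (e s) r _ (mem_range_self s) (hvs.trans ?_))
    have : min b (min (r / 2) μ) ≤ r / 2 := (min_le_right _ _).trans (min_le_left _ _)
    linarith
  · have : min b (min (r / 2) μ) ≤ μ := (min_le_right _ _).trans (min_le_right _ _)
    linarith

/-- The limit of an inverse sequence of compact star-shaped sets all of whose maps into some `ℝ^m`
are approximable by embeddings is cell-like. -/
theorem isCellLikeSpace_of_starConvex_tower (hS : ∀ j, IsCompact (S j))
    (hstar : ∀ j, StarConvex ℝ 0 (S j)) (h0 : ∀ j, (0 : EuclideanSpace ℝ (Fin k)) ∈ S j)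
    (happrox : ∀ j (φ : S j → EuclideanSpace ℝ (Fin m)), Continuous φ → ∀ η > 0,
      ∃ e : S j → EuclideanSpace ℝ (Fin m), Continuous e ∧ Function.Injective e ∧
        ∀ s, dist (e s) (φ s) < η)
    (h : ∀ j, S (j + 1) → S j) (hh : ∀ j, Continuous (h j))
    (p : ∀ j, Y → S j) (hp : ∀ j, Continuous (p j)) (hph : ∀ j y, h j (p (j + 1) y) = p j y)
    (hinj : ∀ y y', (∀ j, p j y = p j y') → y = y')
    (hsurj : ∀ c : InvLimit (M := fun j => S j) h, ∃ y, ∀ j, p j y = c.1 j) :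
    IsCellLikeSpace Y := by
  let Φ : (EuclideanSpace ℝ (Fin m) × EuclideanSpace ℝ (Fin k)) ≃L[ℝ]
    EuclideanSpace ℝ (Fin (m + k)) := ContinuousLinearEquiv.ofFinrankEq (by simp)
  let J : EuclideanSpace ℝ (Fin m) → EuclideanSpace ℝ (Fin (m + k)) := fun v => Φ (v, 0)
  have hJ : Continuous J := Φ.continuous.comp (by fun_prop)
  have hJinj : Function.Injective J := fun v w hvw => by
    have := Φ.injective hvw
    simpa using this
  have : ∀ j, CompactSpace (S j) := fun j => isCompact_iff_compactSpace.1 (hS j)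
  let St : ℕ → Type := fun j =>
    {q : (S j → EuclideanSpace ℝ (Fin m)) × Set (EuclideanSpace ℝ (Fin (m + k))) × ℝ //
      IsGoodStage J p j q.1 q.2.1 q.2.2}
  obtain ⟨q₀⟩ : Nonempty (St 0) := by
    obtain ⟨e, he, hi, -⟩ := happrox 0 (fun _ => 0) continuous_const 1 one_pos
    obtain ⟨C, η, -, -, hC⟩ := exists_goodStage Φ hS hstar h0 p hp h hph 0 e he hi isOpen_univ
      (fun _ => mem_univ _) one_pos
    exact ⟨⟨(e, C, η), hC⟩⟩
  have hnext : ∀ j (q : St j), ∃ q' : St (j + 1), (∀ s, dist (q'.1.1 s) (q.1.1 (h j s)) ≤ q.1.2.2) ∧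
      q'.1.2.1 ⊆ interior q.1.2.1 ∧ q'.1.2.2 ≤ q.1.2.2 / 2 := by
    rintro j ⟨⟨e, C, η⟩, hq⟩
    obtain ⟨e', he', hi', hee'⟩ := happrox (j + 1) (fun s => e (h j s)) (hq.continuous.comp (hh j)) η
      hq.pos
    have hηpos : 0 < η := hq.pos
    obtain ⟨C', η', hC'O, hη', hC'⟩ := exists_goodStage Φ hS hstar h0 p hp h hph (j + 1) e' he' hi'
      (O := interior C) isOpen_interior
      (fun s => hq.mem_interior (e' s) (h j s) ((hee' s).le.trans (by linarith)))
      (half_pos hηpos)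
    exact ⟨⟨(e', C', η'), hC'⟩, fun s => (hee' s).le, hC'O, hη'⟩
  choose nx hnx1 hnx2 hnx3 using hnext
  let q : ∀ j, St j := fun j => Nat.rec q₀ (fun j q => nx j q) j
  let e : ∀ j, S j → EuclideanSpace ℝ (Fin m) := fun j => (q j).1.1
  let C : ℕ → Set (EuclideanSpace ℝ (Fin (m + k))) := fun j => (q j).1.2.1
  let η : ℕ → ℝ := fun j => (q j).1.2.2
  have hgood : ∀ j, IsGoodStage J p j (e j) (C j) (η j) := fun j => (q j).2
  have hee : ∀ j s, dist (e (j + 1) s) (e j (h j s)) ≤ η j := fun j => hnx1 j (q j)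
  have hCC : ∀ j, C (j + 1) ⊆ interior (C j) := fun j => hnx2 j (q j)
  have hηη : ∀ j, η (j + 1) ≤ η j / 2 := fun j => hnx3 j (q j)
  have hηgeo : ∀ j n, η (j + n) ≤ η j / 2 ^ n := by
    intro j n
    induction n with
    | zero => simp
    | succ n ih =>
      calc η (j + (n + 1)) ≤ η (j + n) / 2 := hηη (j + n)
        _ ≤ η j / 2 ^ n / 2 := by gcongr
        _ = η j / 2 ^ (n + 1) := by rw [pow_succ, div_div]
  have hη0 : Filter.Tendsto η Filter.atTop (𝓝 0) := by
    have h1 : Filter.Tendsto (fun n : ℕ => η 0 / 2 ^ n) Filter.atTop (𝓝 0) := by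
      have := (tendsto_pow_atTop_nhds_zero_of_lt_one (r := (1 / 2 : ℝ)) (by norm_num)
        (by norm_num)).const_mul (η 0)
      simpa [div_eq_mul_inv] using this
    refine squeeze_zero (fun n => (hgood n).pos.le) (fun n => ?_) h1
    simpa using hηgeo 0 n
  -- the limit map
  let a : Y → ℕ → EuclideanSpace ℝ (Fin m) := fun y n => e n (p n y)
  have hstep : ∀ j y n, dist (a y (j + n)) (a y (j + (n + 1))) ≤ 2 * η j / 2 / 2 ^ n := by
    intro j y n
    rw [dist_comm]
    have h1 := hee (j + n) (p (j + n + 1) y)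
    rw [hph] at h1
    refine h1.trans ((hηgeo j n).trans_eq ?_)
    ring
  have hlim : ∀ y, ∃ b, Filter.Tendsto (a y) Filter.atTop (𝓝 b) := by
    intro y
    refine cauchySeq_tendsto_of_complete (cauchySeq_of_le_geometric_two (C := 2 * η 0) fun n => ?_)
    have := hstep 0 y n
    simpa only [zero_add] using this
  choose E hE using hlim
  -- The displacements after stage `j` sum to at most `η j + η j / 2 + ⋯ = 2 * η j`, exactly the
  -- tolerance of `mem_interior`; two such errors make up the `4η` of `separating`.
  have hEdist : ∀ j y, dist (e j (p j y)) (E y) ≤ 2 * η j := by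
    intro j y
    have h1 : Filter.Tendsto (fun n => a y (j + n)) Filter.atTop (𝓝 (E y)) := by
      have := (hE y).comp (Filter.tendsto_add_atTop_nat j)
      refine this.congr fun n => ?_
      rw [Function.comp_apply, add_comm]
    have := dist_le_of_le_geometric_two_of_tendsto₀ (hstep j y) h1
    simpa using this
  have hEcont : Continuous E := by
    have hunif : TendstoUniformly (fun j y => e j (p j y)) E Filter.atTop := by
      rw [Metric.tendstoUniformly_iff]
      intro ε hε
      have h2 : Filter.Tendsto (fun j => 2 * η j) Filter.atTop (𝓝 0) := by
        simpa using hη0.const_mul 2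
      filter_upwards [h2.eventually (gt_mem_nhds hε)] with j hj y
      rw [dist_comm]
      exact (hEdist j y).trans_lt hj
    exact hunif.continuous (Filter.Frequently.of_forall fun j => (hgood j).continuous.comp (hp j))
  have hEinj : Function.Injective E := by
    intro y y' hyy'
    refine hinj y y' fun i => ?_
    have h1 : ∀ j, i ≤ j → dist (p i y) (p i y') < 1 / ((j : ℝ) + 1) := by
      intro j hij
      refine (hgood j).separating y y' ?_ i hij
      have h1 := hEdist j y
      have h2 := hEdist j y'
      rw [hyy'] at h1
      have := dist_triangle_right (e j (p j y)) (e j (p j y')) (E y')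
      linarith
    refine dist_le_zero.1 (ge_of_tendsto tendsto_one_div_add_atTop_nhds_zero_nat ?_)
    filter_upwards [Filter.eventually_ge_atTop i] with j hj using (h1 j hj).le
  refine ⟨m + k, fun y => J (E y),
    ((hJ.comp hEcont).isClosedEmbedding (hJinj.comp hEinj)).isEmbedding, C,
    fun j => (hgood j).isCell, hCC, Subset.antisymm ?_ ?_⟩
  · rintro _ ⟨y, rfl⟩
    refine mem_iInter.2 fun j => interior_subset ((hgood j).mem_interior (E y) (p j y) ?_)
    rw [dist_comm]
    exact hEdist j y
  · intro z hz
    -- The nearby points `c j` need not be compatible, so their partial threads are replaced by an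
    -- ultrafilter limit `t`. The images of the `c l` then converge along the ultrafilter both to
    -- the image of `y` and to `z`.
    choose c hc using fun j => (hgood j).near z (mem_iInter.1 hz j)
    obtain ⟨s, U, t, hs, hsh, hU, hst⟩ := exists_limit_thread (M := fun j => S j) h hh c
    obtain ⟨y, hy⟩ := hsurj t
    -- The subtracted term makes the induction telescope: `η ≤ 2 * η - 2 * η'` whenever `η' ≤ η /
    -- 2`.
    have hchain : ∀ l j n, j + n ≤ l →
        dist (e j (s l j)) (e (j + n) (s l (j + n))) ≤ 2 * η j - 2 * η (j + n) := by
      intro l j n hn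
      induction n with
      | zero => simp
      | succ n ih =>
        have h1 := ih (by omega)
        have h2 := hee (j + n) (s l (j + n + 1))
        rw [hsh l (j + n) (by omega), dist_comm] at h2
        have h3 := hηη (j + n)
        have h4 := dist_triangle (e j (s l j)) (e (j + n) (s l (j + n)))
          (e (j + n + 1) (s l (j + n + 1)))
        have h5 : e (j + (n + 1)) (s l (j + (n + 1))) = e (j + n + 1) (s l (j + n + 1)) := rfl
        have h6 : η (j + (n + 1)) = η (j + n + 1) := rfl
        rw [h5, h6]
        linarith
    have hconv : Filter.Tendsto (fun l => e l (c l)) U (𝓝 (E y)) := by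
      rw [Metric.tendsto_nhds]
      intro ε hε
      have h4 : Filter.Tendsto (fun j => 4 * η j) Filter.atTop (𝓝 0) := by
        simpa using hη0.const_mul 4
      obtain ⟨j, hj⟩ := (h4.eventually (gt_mem_nhds (half_pos hε))).exists
      have h5 : Filter.Tendsto (fun l => e j (s l j)) U (𝓝 (e j (p j y))) := by
        rw [hy j]
        exact ((hgood j).continuous.tendsto _).comp ((tendsto_pi_nhds.1 hst) j)
      filter_upwards [Metric.tendsto_nhds.1 h5 (ε / 2) (half_pos hε),
        hU (Filter.eventually_ge_atTop j)] with l hl hjl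
      obtain ⟨n, rfl⟩ := Nat.exists_eq_add_of_le hjl
      have h6 := hchain (j + n) j n le_rfl
      rw [hs (j + n), dist_comm] at h6
      have h7 := hEdist j y
      have h8 := (hgood (j + n)).pos
      have h9 := dist_triangle4 (e (j + n) (c (j + n))) (e j (s (j + n) j)) (e j (p j y)) (E y)
      linarith
    have hz1 : Filter.Tendsto (fun l => J (e l (c l))) U (𝓝 (J (E y))) := (hJ.tendsto _).comp hconv
    have hz2 : Filter.Tendsto (fun l => J (e l (c l))) U (𝓝 z) := by
      refine Filter.Tendsto.mono_left ?_ hU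
      rw [tendsto_iff_dist_tendsto_zero]
      refine squeeze_zero (fun _ => dist_nonneg) (fun l => ?_)
        tendsto_one_div_add_atTop_nhds_zero_nat
      rw [dist_comm]
      exact (hc l).le
    exact ⟨y, tendsto_nhds_unique hz1 hz2⟩

end Tower

/-! ### The map `π` and its fibers -/

theorem bondComp_thread {M : ℕ → Type*} (f : ∀ i, M (i + 1) → M i) (x : InvLimit f) (j k : ℕ) :
    bondComp f j k (x.1 (j + k)) = x.1 j := by
  induction k with
  | zero => rfl
  | succ k ih =>
    change bondComp f j k (f (j + k) (x.1 (j + k + 1))) = _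
    rw [x.2, ih]

/-- Phrased for a whole family `z`, which avoids transporting points between `M (j + 1 + k)` and `M
(j + (k + 1))`. -/
theorem bondComp_succ_left {M : ℕ → Type*} (f : ∀ i, M (i + 1) → M i) (j k : ℕ) (z : ∀ i, M i) :
    f j (bondComp f (j + 1) k (z (j + 1 + k))) = bondComp f j (k + 1) (z (j + (k + 1))) := by
  induction k generalizing z with
  | zero => rfl
  | succ k ih => exact ih fun i => f i (z (i + 1))

theorem continuous_bondComp {M : ℕ → Type*} [∀ i, TopologicalSpace (M i)] (f : ∀ i, M (i + 1) → M i)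
    (hf : ∀ i, Continuous (f i)) (j k : ℕ) : Continuous (bondComp f j k) := by
  induction k with
  | zero => exact continuous_id
  | succ k ih => exact ih.comp (hf (j + k))

theorem dist_lt_of_diam_image_lt {X Y : Type*} [MetricSpace X] [MetricSpace Y] [CompactSpace Y]
    (f : X → Y) {s : Set X} {r : ℝ} (h : Metric.diam (f '' s) < r) {a b : X} (ha : a ∈ s)
    (hb : b ∈ s) : dist (f a) (f b) < r :=
  (Metric.dist_le_diam_of_mem Metric.isBounded_of_compactSpace (mem_image_of_mem f ha)
    (mem_image_of_mem f hb)).trans_lt h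

section FiberMap

variable {P : ℕ → Type*} [∀ i, MetricSpace (P i)] [∀ i, CompactSpace (P i)]
  {f : ∀ i, P (i + 1) → P i} {A : ∀ i, Set (P i)} {G : ∀ i, A (i + 1) → A i} {ε δ : ℕ → ℝ}

/-- One third from (I) and one third from (II). A `δ`-ball thus goes straight into an `ε`-ball,
which is why the two systems of balls have equal limits. -/
theorem dist_restrict_lt (hεδ : ∀ i, 0 < ε i ∧ ε i < δ i / 3)
    (h1 : ∀ i z, dist (G i z : P i) (f i z) < ε i / 3)
    (h2 : ∀ i (y : P (i + 1)), Metric.diam (f i '' Metric.closedBall y (δ (i + 1))) < ε i / 3)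
    {i : ℕ} {x : P (i + 1)} {z : A (i + 1)} (hz : dist (z : P (i + 1)) x ≤ δ (i + 1)) :
    dist (G i z : P i) (f i x) < ε i := by
  have hd : 0 ≤ δ (i + 1) := by linarith [hεδ (i + 1)]
  have h3 := dist_lt_of_diam_image_lt (f i) (h2 i x) (a := z) (b := x) hz (by simpa using hd)
  have h4 := h1 i z
  have h5 := dist_triangle (G i z : P i) (f i z) (f i x)
  linarith [(hεδ i).1]

theorem restrict_mem_closedBall (hεδ : ∀ i, 0 < ε i ∧ ε i < δ i / 3)
    (h1 : ∀ i z, dist (G i z : P i) (f i z) < ε i / 3)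
    (h2 : ∀ i (y : P (i + 1)), Metric.diam (f i '' Metric.closedBall y (δ (i + 1))) < ε i / 3)
    (x : InvLimit f) {i : ℕ} {z : A (i + 1)}
    (hz : (z : P (i + 1)) ∈ Metric.closedBall (x.1 (i + 1)) (ε (i + 1))) :
    (G i z : P i) ∈ Metric.closedBall (x.1 i) (ε i) := by
  have h3 : ε (i + 1) ≤ δ (i + 1) := by linarith [hεδ (i + 1)]
  have h4 := dist_restrict_lt hεδ h1 h2 ((Metric.mem_closedBall.1 hz).trans h3)
  rw [x.2 i] at h4
  exact h4.le

theorem exists_fiber_map (hf : ∀ i, Continuous (f i)) (hεδ : ∀ i, 0 < ε i ∧ ε i < δ i / 3)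
    (h1 : ∀ i z, dist (G i z : P i) (f i z) < ε i / 3)
    (h2 : ∀ i (y : P (i + 1)), Metric.diam (f i '' Metric.closedBall y (δ (i + 1))) < ε i / 3)
    (h3 : ∀ j k (y : P (j + (k + 1))),
      Metric.diam (bondComp f j (k + 1) '' Metric.closedBall y (ε (j + (k + 1))))
        < ε j / 2 ^ (j + (k + 1) + 1)) :
    ∃ π : InvLimit (M := fun i => A i) G → InvLimit f, Continuous π ∧ ∀ x : InvLimit f,
      π ⁻¹' {x} = {z | ∀ i, (z.1 i : P i) ∈ Metric.closedBall (x.1 i) (δ i)} ∧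
      π ⁻¹' {x} = {z | ∀ i, (z.1 i : P i) ∈ Metric.closedBall (x.1 i) (ε i)} := by
  have h3' : ∀ j k (a y : P (j + (k + 1))), dist a y ≤ ε (j + (k + 1)) →
      dist (bondComp f j (k + 1) a) (bondComp f j (k + 1) y) ≤ ε j / 2 / 2 / 2 ^ k := by
    intro j k a y hay
    refine (dist_lt_of_diam_image_lt _ (h3 j k y) hay
      (by simpa using (hεδ (j + (k + 1))).1.le)).le.trans ?_
    -- Discarding the factor `2 ^ j` gives a geometric bound `C / 2 / 2 ^ k` with `C = ε j / 2`, of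
    -- total at most `ε j / 2`.
    have h5 : (2 : ℝ) ^ (k + 2) ≤ 2 ^ (j + (k + 1) + 1) :=
      pow_le_pow_right₀ (by norm_num) (by omega)
    have h6 : ε j / 2 / 2 / 2 ^ k = ε j / 2 ^ (k + 2) := by rw [pow_add]; field_simp
    rw [h6]
    exact div_le_div_of_nonneg_left (hεδ j).1.le (by positivity) h5
  let Z := InvLimit (M := fun i => A i) G
  let B : Z → ∀ j : ℕ, ℕ → P j := fun z j k => bondComp f j k (z.1 (j + k))
  have hclose : ∀ (z : Z) i, dist (z.1 i : P i) (f i (z.1 (i + 1))) < ε i / 3 := fun z i => by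
    have := h1 i (z.1 (i + 1))
    rwa [z.2 i] at this
  have hB : ∀ z j k, dist (B z j (k + 1)) (B z j (k + 1 + 1)) ≤ ε j / 2 / 2 / 2 ^ k := fun z j k =>
    h3' j k _ _ ((hclose z (j + (k + 1))).le.trans (by linarith [(hεδ (j + (k + 1))).1]))
  -- The sequence starts at `k + 1` because (III) concerns strictly later stages only.
  have hlim : ∀ z j, ∃ a, Filter.Tendsto (fun k => B z j (k + 1)) Filter.atTop (𝓝 a) := fun z j =>
    cauchySeq_tendsto_of_complete (cauchySeq_of_le_geometric_two (hB z j))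
  choose ρ hρ using hlim
  have hρd : ∀ z j k, dist (B z j (k + 1)) (ρ z j) ≤ ε j / 2 / 2 ^ k := fun z j k =>
    dist_le_of_le_geometric_two_of_tendsto (hB z j) (hρ z j) k
  have hρthread : ∀ z j, f j (ρ z (j + 1)) = ρ z j := by
    intro z j
    have h4 : Filter.Tendsto (fun k => f j (B z (j + 1) (k + 1))) Filter.atTop
        (𝓝 (f j (ρ z (j + 1)))) := ((hf j).tendsto _).comp (hρ z (j + 1))
    have h5 : Filter.Tendsto (fun k => B z j (k + 1 + 1)) Filter.atTop (𝓝 (ρ z j)) :=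
      (Filter.tendsto_add_atTop_iff_nat (f := fun k => B z j (k + 1)) 1).2 (hρ z j)
    refine tendsto_nhds_unique (h4.congr fun k => ?_) h5
    exact bondComp_succ_left f j (k + 1) fun i => (z.1 i : P i)
  have hgeo : ∀ j, Filter.Tendsto (fun k : ℕ => ε j / 2 / 2 ^ k) Filter.atTop (𝓝 0) := by
    intro j
    have := (tendsto_pow_atTop_nhds_zero_of_lt_one (r := (1 / 2 : ℝ)) (by norm_num)
      (by norm_num)).const_mul (ε j / 2)
    simpa [div_eq_mul_inv] using this
  have hρcont : ∀ j, Continuous fun z => ρ z j := by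
    intro j
    have hunif : TendstoUniformly (fun k z => B z j (k + 1)) (fun z => ρ z j) Filter.atTop := by
      rw [Metric.tendstoUniformly_iff]
      intro η hη
      filter_upwards [(hgeo j).eventually (gt_mem_nhds hη)] with k hk z
      rw [dist_comm]
      exact (hρd z j k).trans_lt hk
    refine hunif.continuous (Filter.Frequently.of_forall fun k => ?_)
    exact (continuous_bondComp f hf j (k + 1)).comp
      (continuous_subtype_val.comp ((continuous_apply _).comp continuous_subtype_val))
  refine ⟨fun z => ⟨ρ z, hρthread z⟩, (continuous_pi hρcont).subtype_mk _, fun x => ?_⟩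
  have hεsub : ∀ z : Z, ρ z = x.1 → ∀ i, dist (z.1 i : P i) (x.1 i) ≤ ε i := by
    intro z hz i
    rw [← hz]
    have h4 := hclose z i
    have h5 := hρd z i 0
    have h6 : B z i (0 + 1) = f i (z.1 (i + 1)) := rfl
    rw [h6, pow_zero, div_one] at h5
    have h7 := dist_triangle (z.1 i : P i) (f i (z.1 (i + 1))) (ρ z i)
    linarith [(hεδ i).1]
  have hδsub : ∀ z : Z, (∀ i, dist (z.1 i : P i) (x.1 i) ≤ δ i) → ρ z = x.1 := by
    -- One bonding map improves `δ` to `ε`; then (III) compares the images of `z` with those of `x`,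
    -- which are constantly `x j`.
    intro z hz
    have hzε : ∀ i, dist (z.1 i : P i) (x.1 i) ≤ ε i := fun i => by
      have := dist_restrict_lt hεδ h1 h2 (hz (i + 1))
      rw [z.2 i, x.2 i] at this
      exact this.le
    funext j
    refine tendsto_nhds_unique (hρ z j) ?_
    rw [tendsto_iff_dist_tendsto_zero]
    refine squeeze_zero (fun _ => dist_nonneg) (fun k => ?_) (hgeo j)
    have h4 := h3' j k (z.1 (j + (k + 1))) (x.1 (j + (k + 1))) (hzε _)
    rw [bondComp_thread] at h4
    refine h4.trans ?_
    gcongr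
    linarith [(hεδ j).1]
  have hiff : ∀ z : Z, z ∈ (fun z => (⟨ρ z, hρthread z⟩ : InvLimit f)) ⁻¹' {x} ↔ ρ z = x.1 :=
    fun z => Subtype.ext_iff
  constructor
  · ext z
    rw [hiff]
    exact ⟨fun h i => (hεsub z h i).trans (by linarith [hεδ i]), hδsub z⟩
  · ext z
    rw [hiff]
    exact ⟨fun h i => hεsub z h i,
      fun h => hδsub z fun i => (h i).trans (by linarith [hεδ i])⟩

/-- The balls intersected with the `A i` form an inverse sequence of nonempty compact spaces. -/
theorem exists_thread_mem_closedBall (hA : ∀ i, IsClosed (A i)) (hG : ∀ i, Continuous (G i))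
    (hεδ : ∀ i, 0 < ε i ∧ ε i < δ i / 3)
    (h1 : ∀ i z, dist (G i z : P i) (f i z) < ε i / 3)
    (h2 : ∀ i (y : P (i + 1)), Metric.diam (f i '' Metric.closedBall y (δ (i + 1))) < ε i / 3)
    (x : InvLimit f) (hne : ∀ i, ∃ z : A i, (z : P i) ∈ Metric.closedBall (x.1 i) (ε i)) :
    ∃ z : InvLimit (M := fun i => A i) G,
      ∀ i, (z.1 i : P i) ∈ Metric.closedBall (x.1 i) (ε i) := by
  let K : ℕ → Type _ := fun i => {z : A i // (z : P i) ∈ Metric.closedBall (x.1 i) (ε i)}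
  have : ∀ i, CompactSpace (A i) := fun i => isCompact_iff_compactSpace.1 (hA i).isCompact
  have : ∀ i, CompactSpace (K i) := fun i =>
    isCompact_iff_compactSpace.1
      (Metric.isClosed_closedBall.preimage continuous_subtype_val).isCompact
  let g : ∀ i, K (i + 1) → K i := fun i z => ⟨G i z.1, restrict_mem_closedBall hεδ h1 h2 x z.2⟩
  have hg : ∀ i, Continuous (g i) := fun i =>
    ((hG i).comp continuous_subtype_val).subtype_mk _
  choose a ha using hne
  obtain ⟨-, -, c, -⟩ := exists_limit_thread g hg fun i => ⟨a i, ha i⟩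
  exact ⟨⟨fun i => (c.1 i).1, fun i => congrArg Subtype.val (c.2 i)⟩, fun i => (c.1 i).2⟩

end FiberMap

/-! ### Skeleta, subpolyhedra and pushes in a triangulated space -/

theorem IsThinSet.of_finite {d : ℕ} {E : Type*} [NormedAddCommGroup E] [NormedSpace ℝ E] {A : Set E}
    {κ : Type*} [Finite κ] (φ : κ → (Fin d → ℝ) → E) (hφ : ∀ i, ContDiff ℝ 1 (φ i))
    (hA : A ⊆ ⋃ i, range (φ i)) : IsThinSet d A := by
  obtain ⟨k, ⟨e⟩⟩ := Finite.exists_equiv_fin κ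
  refine ⟨k, fun i => φ (e.symm i), fun i => hφ _, fun x hx => ?_⟩
  obtain ⟨i, hi⟩ := mem_iUnion.1 (hA hx)
  exact mem_iUnion.2 ⟨e i, by simpa using hi⟩

/-- A simplex with at most `d + 1` vertices lies in an affine image of `ℝ^d`. -/
theorem exists_contDiff_convexHull_subset_range {d : ℕ} {E : Type*} [NormedAddCommGroup E]
    [NormedSpace ℝ E] {t : Finset E} (hne : t.Nonempty) (ht : t.card ≤ d + 1) :
    ∃ φ : (Fin d → ℝ) → E, ContDiff ℝ 1 φ ∧ convexHull ℝ (t : Set E) ⊆ range φ := by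
  obtain ⟨emb⟩ : Nonempty (t ↪ Fin (d + 1)) := Function.Embedding.nonempty_of_card_le (by simpa)
  have : Nonempty t := hne.to_subtype
  let a : Fin (d + 1) → E := fun i => (Function.invFun emb i : t)
  have ha : ∀ y ∈ t, ∃ i, a i = y := fun y hy => by
    obtain ⟨i, hi⟩ := Function.invFun_surjective emb.injective ⟨y, hy⟩
    exact ⟨i, congrArg Subtype.val hi⟩
  let φ : (Fin d → ℝ) → E := fun u => a 0 + ∑ i, u i • (a i.succ - a 0)
  refine ⟨φ, by fun_prop, convexHull_min ?_ ?_⟩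
  · intro y hy
    obtain ⟨i, rfl⟩ := ha y hy
    rcases Fin.eq_zero_or_eq_succ i with rfl | ⟨j, rfl⟩
    · exact ⟨0, by simp [φ]⟩
    · exact ⟨Pi.single j 1, by simp [φ, Pi.single_apply]⟩
  · rintro _ ⟨u, rfl⟩ _ ⟨v, rfl⟩ α β _ _ hαβ
    refine ⟨α • u + β • v, ?_⟩
    have h0 : a 0 = α • a 0 + β • a 0 := by rw [← add_smul, hαβ, one_smul]
    simp only [φ, Pi.add_apply, Pi.smul_apply, smul_eq_mul, add_smul, Finset.sum_add_distrib,
      smul_add, Finset.smul_sum, mul_smul]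
    nth_rewrite 1 [h0]
    abel

theorem ThinSpace.of_unique (d : ℕ) : ThinSpace d Unit :=
  ⟨0, fun _ => 0, continuous_const, fun _ _ _ => rfl, 1, fun _ _ => 0, fun _ => contDiff_const,
    fun _ _ => mem_iUnion.2 ⟨0, 0, Subsingleton.elim _ _⟩⟩

namespace Triangulation

variable {P : Type*} [TopologicalSpace P] (L : Triangulation P)

open Classical in
/-- The vertices of a triangulation. -/
noncomputable def vertexFinset : Finset (EuclideanSpace ℝ (Fin L.ambientDim)) :=
  L.finite_faces.toFinset.biUnion id

theorem face_subset_vertexFinset :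
    ∀ s ∈ L.complex.faces, s ⊆ L.vertexFinset := by
  classical
  intro s hs
  exact Finset.subset_biUnion_of_mem id (L.finite_faces.mem_toFinset.2 hs)

/-- Barycentric coordinates. -/
noncomputable def bary : P ≃ₜ Realization (absFaces L.complex L.vertexFinset) :=
  L.homeo.symm.trans (realizationHomeo L.face_subset_vertexFinset).symm

theorem continuous_point : Continuous L.point :=
  continuous_subtype_val.comp L.homeo.symm.continuous

theorem point_injective : Function.Injective L.point :=
  Subtype.val_injective.comp L.homeo.symm.injective

theorem baryPoint_bary (p : P) : baryPoint L.vertexFinset (L.bary p).1 = L.point p := by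
  rw [← coe_realizationHomeo L.face_subset_vertexFinset]
  simp [bary, point]

theorem mem_simplex_iff {t : Finset (EuclideanSpace ℝ (Fin L.ambientDim))}
    (ht : t ∈ L.complex.faces) (p : P) :
    p ∈ L.simplex t ↔ (wsupp (L.bary p).1).map (Function.Embedding.subtype _) ⊆ t := by
  constructor
  · intro hp
    obtain ⟨lam, hlam, hsub⟩ := exists_realization_eq L.face_subset_vertexFinset ht hp
    rw [← L.baryPoint_bary] at hlam
    have := baryPoint_injOn L.face_subset_vertexFinset lam.2.1 (L.bary p).2.1 lam.2.2
      (L.bary p).2.2 hlam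
    rwa [this] at hsub
  · intro hsub
    have := baryPoint_mem_convexHull (L.bary p).2.1 Finset.Subset.rfl
    rw [L.baryPoint_bary] at this
    exact convexHull_mono (by exact_mod_cast hsub) this

theorem mem_skeleton_iff (d : ℕ) (p : P) :
    p ∈ L.skeleton d ↔ (wsupp (L.bary p).1).card ≤ d + 1 := by
  constructor
  · rintro ⟨s, hs, hc, hp⟩
    have := Finset.card_le_card ((L.mem_simplex_iff hs p).1 hp)
    rw [Finset.card_map] at this
    omega
  · intro h
    exact ⟨_, (L.bary p).2.2, by rwa [Finset.card_map],
      (L.mem_simplex_iff (L.bary p).2.2 p).2 Finset.Subset.rfl⟩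

theorem isClosed_skeleton (d : ℕ) : IsClosed (L.skeleton d) := by
  have : L.skeleton d = ⋃ s ∈ {s ∈ L.complex.faces | s.card ≤ d + 1}, L.simplex s := by
    ext p
    simp [skeleton, and_assoc]
  rw [this]
  refine (L.finite_faces.subset (sep_subset _ _)).isClosed_biUnion fun s _ => ?_
  exact (s.finite_toSet.isCompact_convexHull (𝕜 := ℝ)).isClosed.preimage L.continuous_point

theorem thinSpace_skeleton (d : ℕ) : ThinSpace d (L.skeleton d) := by
  have : Finite L.complex.faces := L.finite_faces
  choose φ hφ hsub using fun s : {s : L.complex.faces // s.1.card ≤ d + 1} =>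
    exists_contDiff_convexHull_subset_range
      (Geometry.SimplicialComplex.nonempty_of_mem_faces s.1.2) s.2
  refine ⟨L.ambientDim, fun p => L.point p, L.continuous_point.comp continuous_subtype_val,
    L.point_injective.comp Subtype.val_injective, IsThinSet.of_finite φ hφ ?_⟩
  rintro _ ⟨⟨p, s, hs, hc, hp⟩, rfl⟩
  exact mem_iUnion.2 ⟨⟨⟨s, hs⟩, hc⟩, hsub _ hp⟩

theorem IsSubpolyhedron.exists_homeomorph {L : Triangulation P} {A : Set P}
    (hA : L.IsSubpolyhedron A) :
    ∃ (V : Type) (_ : Fintype V) (K : Set (Finset V)), IsDownClosed K ∧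
      Nonempty (A ≃ₜ Realization K) := by
  classical
  obtain ⟨J, hfin, hJ⟩ := hA
  have hW : ∀ s ∈ J.faces, s ⊆ hfin.toFinset.biUnion id := fun s hs =>
    Finset.subset_biUnion_of_mem id (hfin.mem_toFinset.2 hs)
  refine ⟨↥(hfin.toFinset.biUnion id), inferInstance, _,
    isDownClosed_absFaces J (hfin.toFinset.biUnion id), ⟨?_⟩⟩
  have h1 : IsEmbedding L.point := IsEmbedding.subtypeVal.comp L.homeo.symm.isEmbedding
  exact (h1.homeomorphImage A).trans
    ((Homeomorph.setCongr hJ.symm).trans (realizationHomeo hW).symm)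

theorem IsSubpolyhedron.isCompact {L : Triangulation P} {A : Set P} (hA : L.IsSubpolyhedron A) :
    IsCompact A := by
  obtain ⟨V, _, K, hK, ⟨e⟩⟩ := hA.exists_homeomorph
  have := Realization.compactSpace hK
  exact isCompact_iff_compactSpace.2 e.symm.compactSpace

/-- A contractible polyhedron is an absolute extensor. -/
theorem IsSubpolyhedron.tietzeExtension {L : Triangulation P} {A : Set P} (hA : L.IsSubpolyhedron A)
    [ContractibleSpace A] : TietzeExtension A := by
  obtain ⟨V, _, K, hK, ⟨e⟩⟩ := hA.exists_homeomorph
  have : ContractibleSpace (Realization K) := e.symm.contractibleSpace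
  have := Realization.tietzeExtension hK
  exact TietzeExtension.of_homeo e

end Triangulation

namespace Triangulation

variable {P : Type*} [MetricSpace P] [CompactSpace P] (L : Triangulation P)

/-- Both points lie in the carrier simplex of `p`. Since pushes only shrink supports, this bounds
their displacement. -/
theorem dist_le_mesh {p q : P} (h : wsupp (L.bary q).1 ⊆ wsupp (L.bary p).1) :
    dist p q ≤ L.mesh := by
  have : Finite L.complex.faces := L.finite_faces
  let t : L.complex.faces := ⟨_, (L.bary p).2.2⟩
  have hp : p ∈ L.simplex t.1 := (L.mem_simplex_iff t.2 p).2 Finset.Subset.rfl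
  have hq : q ∈ L.simplex t.1 := (L.mem_simplex_iff t.2 q).2 (Finset.map_subset_map.2 h)
  refine (Metric.dist_le_diam_of_mem Metric.isBounded_of_compactSpace hp hq).trans ?_
  exact le_ciSup (f := fun s : L.complex.faces => Metric.diam (L.simplex s.1))
    (finite_range _).bddAbove t

/-- A map from a `d`-dimensional space can be pushed into the `d`-skeleton within the simplices,
relative to the points already there. -/
theorem exists_push {d : ℕ} {Q : Type*} [TopologicalSpace Q] [CompactSpace Q] (hQ : ThinSpace d Q)
    (F : Q → P) (hF : Continuous F) :
    ∃ F' : Q → L.skeleton d, Continuous F' ∧ (∀ x, F x ∈ L.skeleton d → (F' x : P) = F x) ∧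
      ∀ x, dist (F x) (F' x) ≤ L.mesh := by
  obtain ⟨F₁, hc, hsum, hsub, hcard, heq⟩ := hQ.exists_push (fun x => (L.bary (F x)).1)
    (continuous_subtype_val.comp (L.bary.continuous.comp hF)) fun x => (L.bary (F x)).2.1
  let F₂ : Q → Realization (absFaces L.complex L.vertexFinset) := fun x =>
    ⟨F₁ x, hsum x, isDownClosed_absFaces _ _ _ (L.bary (F x)).2.2 _ (hsub x)
      (wsupp_nonempty (hsum x))⟩
  have hF₂ : Continuous F₂ := hc.subtype_mk _
  have hb : ∀ x, L.bary (L.bary.symm (F₂ x)) = F₂ x := fun x => L.bary.apply_symm_apply _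
  refine ⟨fun x => ⟨L.bary.symm (F₂ x), (L.mem_skeleton_iff d _).2 ?_⟩,
    (L.bary.symm.continuous.comp hF₂).subtype_mk _, fun x hx => ?_, fun x => L.dist_le_mesh ?_⟩
  · rw [hb]
    exact hcard x
  · have : F₂ x = L.bary (F x) := Subtype.ext (heq x ((L.mem_skeleton_iff d _).1 hx))
    change L.bary.symm (F₂ x) = F x
    rw [this, L.bary.symm_apply_apply]
  · change wsupp (L.bary (L.bary.symm (F₂ x))).1 ⊆ _
    rw [hb]
    exact hsub x

/-- The push applied to a map from a single point. -/
theorem exists_mem_skeleton_dist_le (d : ℕ) (p : P) : ∃ z : L.skeleton d, dist p z ≤ L.mesh := by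
  obtain ⟨F, -, -, hF⟩ := L.exists_push (ThinSpace.of_unique d) (fun _ => p) continuous_const
  exact ⟨F (), hF ()⟩

variable {L}

/-- The `d`-skeleton retracts to the part of it near a contractible subpolyhedron. -/
theorem IsSubpolyhedron.exists_retraction {A : Set P} (hA : L.IsSubpolyhedron A)
    [ContractibleSpace A] (d : ℕ) :
    ∃ r : L.skeleton d → L.skeleton d, Continuous r ∧
      (∀ z : L.skeleton d, (z : P) ∈ A → r z = z) ∧
      ∀ z, ∃ a ∈ A, dist a (r z) ≤ L.mesh := by
  have := hA.tietzeExtension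
  have : CompactSpace (L.skeleton d) := isCompact_iff_compactSpace.1 (L.isClosed_skeleton d).isCompact
  let B : Set (L.skeleton d) := Subtype.val ⁻¹' A
  have hB : IsClosed B := hA.isCompact.isClosed.preimage continuous_subtype_val
  obtain ⟨r₀, hr₀⟩ := ContinuousMap.exists_restrict_eq hB
    (⟨fun z => ⟨z.1.1, z.2⟩, by fun_prop⟩ : C(B, A))
  have hr₀' : ∀ z : L.skeleton d, (z : P) ∈ A → (r₀ z : P) = z := fun z hz =>
    congrArg Subtype.val (DFunLike.congr_fun hr₀ (⟨z, hz⟩ : B))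
  -- The extension into `A` may leave the skeleton; the push returns it there at a cost of at most
  -- the mesh, without moving the points of `A` already in the skeleton.
  obtain ⟨r, hr, hreq, hrd⟩ := L.exists_push (L.thinSpace_skeleton d) (fun z => (r₀ z : P))
    (continuous_subtype_val.comp r₀.continuous)
  refine ⟨r, hr, fun z hz => Subtype.ext ?_, fun z => ⟨r₀ z, (r₀ z).2, hrd z⟩⟩
  have h1 := hr₀' z hz
  rw [hreq z (by rw [h1]; exact z.2), h1]

/-- A map into the `d`-skeleton with values in a contractible subpolyhedron extends, within the
`d`-skeleton, to any `d`-dimensional space. -/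
theorem IsSubpolyhedron.exists_extension {A : Set P} (hA : L.IsSubpolyhedron A)
    [ContractibleSpace A] {d : ℕ} {K Q : Type*} [TopologicalSpace K] [TopologicalSpace Q]
    [CompactSpace Q] [T2Space Q] (hQ : ThinSpace d Q) {j : K → Q} (hj : IsClosedEmbedding j)
    (ψ : K → P) (hψ : Continuous ψ) (hψA : ∀ z, ψ z ∈ A) (hψd : ∀ z, ψ z ∈ L.skeleton d) :
    ∃ F : Q → L.skeleton d, Continuous F ∧ ∀ z, (F (j z) : P) = ψ z := by
  have := hA.tietzeExtension
  obtain ⟨F₀, hF₀⟩ := ContinuousMap.exists_extension' hj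
    (⟨fun z => ⟨ψ z, hψA z⟩, by fun_prop⟩ : C(K, A))
  have hF₀' : ∀ z, (F₀ (j z) : P) = ψ z := fun z => congrArg Subtype.val (congrFun hF₀ z)
  obtain ⟨F, hF, hFeq, -⟩ := L.exists_push hQ (fun q => (F₀ q : P))
    (continuous_subtype_val.comp F₀.continuous)
  refine ⟨F, hF, fun z => ?_⟩
  rw [hFeq _ (by rw [hF₀' z]; exact hψd z), hF₀' z]

end Triangulation

/-! ### Geometric cones -/

section Cone

variable {m m' : ℕ} {K : Type*}
  (Ψ : (EuclideanSpace ℝ (Fin m) × ℝ) ≃L[ℝ] EuclideanSpace ℝ (Fin m'))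
  (φ : K → EuclideanSpace ℝ (Fin m))

/-- The geometric cone over an embedded space. -/
def coneSet : Set (EuclideanSpace ℝ (Fin m')) :=
  range fun q : K × unitInterval => Ψ ((q.2 : ℝ) • φ q.1, (q.2 : ℝ))

/-- The inclusion of the base of the cone. -/
def coneBase (z : K) : coneSet Ψ φ := ⟨Ψ (φ z, 1), (z, 1), by simp⟩

variable {φ}

theorem isCompact_coneSet [TopologicalSpace K] [CompactSpace K] (hφ : Continuous φ) : IsCompact (coneSet Ψ φ) :=
  isCompact_range (by fun_prop)

theorem starConvex_coneSet : StarConvex ℝ 0 (coneSet Ψ φ) := by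
  rw [starConvex_zero_iff]
  rintro _ ⟨⟨z, t⟩, rfl⟩ a ha0 ha1
  refine ⟨(z, ⟨a * t, mul_nonneg ha0 t.2.1, mul_le_one₀ ha1 t.2.1 t.2.2⟩), ?_⟩
  simp [← map_smul, mul_smul]

theorem zero_mem_coneSet [Nonempty K] : (0 : EuclideanSpace ℝ (Fin m')) ∈ coneSet Ψ φ := by
  obtain ⟨z⟩ := ‹Nonempty K›
  exact ⟨(z, 0), by simp⟩

theorem continuous_coneBase [TopologicalSpace K] (hφ : Continuous φ) : Continuous (coneBase Ψ φ) :=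
  Continuous.subtype_mk (by fun_prop) _

theorem coneBase_injective (hφ : Function.Injective φ) : Function.Injective (coneBase Ψ φ) := by
  intro z w hzw
  have := Ψ.injective (congrArg Subtype.val hzw)
  exact hφ (congrArg Prod.fst this)

theorem thinSpace_coneSet {d : ℕ} (h : IsThinSet d (range φ)) :
    ThinSpace (d + 1) (coneSet Ψ φ) := by
  obtain ⟨k, ψ, hψ, hs⟩ := h
  refine ⟨m', Subtype.val, continuous_subtype_val, Subtype.val_injective, k,
    fun i u => Ψ (u 0 • ψ i (fun j => u j.succ), u 0), fun i => ?_, ?_⟩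
  · have h1 : ContDiff ℝ 1 fun u : Fin (d + 1) → ℝ => ψ i (fun j => u j.succ) :=
      (hψ i).comp (by fun_prop)
    have h2 : ContDiff ℝ 1 fun u : Fin (d + 1) → ℝ => u 0 := by fun_prop
    exact Ψ.contDiff.comp ((h2.smul h1).prodMk h2)
  · rintro _ ⟨⟨_, ⟨z, t⟩, rfl⟩, rfl⟩
    obtain ⟨i, u, hu⟩ := mem_iUnion.1 (hs (mem_range_self z))
    refine mem_iUnion.2 ⟨i, Fin.cons (t : ℝ) u, ?_⟩
    simp [hu]

end Cone

/-! ### Compactness of inverse limits and threads over even indices -/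

theorem InvLimit.compactSpace {M : ℕ → Type*} [∀ i, TopologicalSpace (M i)]
    [∀ i, CompactSpace (M i)] [∀ i, T2Space (M i)] (g : ∀ i, M (i + 1) → M i)
    (hg : ∀ i, Continuous (g i)) : CompactSpace (InvLimit g) := by
  refine isCompact_iff_compactSpace.1
    (?_ : IsCompact {x : ∀ i, M i | ∀ i, g i (x (i + 1)) = x i})
  refine IsClosed.isCompact ?_
  rw [show {x : ∀ i, M i | ∀ i, g i (x (i + 1)) = x i} = ⋂ i, {x | g i (x (i + 1)) = x i} by
    ext; simp]
  exact isClosed_iInter fun i =>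
    isClosed_eq ((hg i).comp (continuous_apply (i + 1))) (continuous_apply i)

/-- A thread over the even indices extends to a thread. -/
theorem exists_thread_of_even {M : ℕ → Type*} (g : ∀ i, M (i + 1) → M i) (c : ∀ j, M (2 * j))
    (hc : ∀ j, g (2 * j) (g (2 * j + 1) (c (j + 1))) = c j) :
    ∃ z : InvLimit g, ∀ j, z.1 (2 * j) = c j := by
  -- Each value is pinned down through an equation for the index, so that the parity cases can be
  -- chosen uniformly despite the dependent types.
  have key : ∀ i, ∃ w : M i, (∀ j (h : 2 * j = i), w = h ▸ c j) ∧
      ∀ j (h : 2 * j + 1 = i), w = h ▸ g (2 * j + 1) (c (j + 1)) := by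
    intro i
    rcases Nat.even_or_odd' i with ⟨j, rfl | rfl⟩
    · refine ⟨c j, fun j' h => ?_, fun j' h => by omega⟩
      obtain rfl : j' = j := by omega
      rfl
    · refine ⟨g (2 * j + 1) (c (j + 1)), fun j' h => by omega, fun j' h => ?_⟩
      obtain rfl : j' = j := by omega
      rfl
  choose w hw1 hw2 using key
  refine ⟨⟨w, fun i => ?_⟩, fun j => hw1 _ j rfl⟩
  rcases Nat.even_or_odd' i with ⟨j, rfl | rfl⟩
  · rw [hw1 _ j rfl, hw2 _ j rfl]
    exact hc j
  · rw [hw2 _ j rfl]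
    exact congrArg (g (2 * j + 1)) (hw1 _ (j + 1) rfl)

/-! ### Cell-likeness of the fibers -/

section Fiber

set_option linter.unusedSectionVars false

variable {n : ℕ} {P : ℕ → Type*} [∀ i, MetricSpace (P i)] [∀ i, CompactSpace (P i)]
  {f : ∀ i, P (i + 1) → P i} {L : ∀ i, Triangulation (P i)} {ε δ : ℕ → ℝ}

/-- The part of the `n`-skeleton in a closed ball. -/
abbrev SkeletonBall (L : ∀ i, Triangulation (P i)) (n : ℕ) (ε : ℕ → ℝ) (x : ∀ i, P i) (i : ℕ) :
    Type _ :=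
  {z : (L i).skeleton n // (z : P i) ∈ Metric.closedBall (x i) (ε i)}

theorem SkeletonBall.compactSpace (x : ∀ i, P i) (i : ℕ) :
    CompactSpace (SkeletonBall L n ε x i) := by
  have : CompactSpace ((L i).skeleton n) :=
    isCompact_iff_compactSpace.1 ((L i).isClosed_skeleton n).isCompact
  exact isCompact_iff_compactSpace.1
    (Metric.isClosed_closedBall.preimage continuous_subtype_val).isCompact

theorem exists_skeletonBall (hmesh : ∀ i, (L i).mesh < ε i) (x : ∀ i, P i) (i : ℕ) :
    ∃ z : (L i).skeleton n, (z : P i) ∈ Metric.closedBall (x i) (ε i) := by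
  obtain ⟨z, hz⟩ := (L i).exists_mem_skeleton_dist_le n (x i)
  rw [dist_comm] at hz
  exact ⟨z, hz.trans (hmesh i).le⟩

variable {G : ∀ i, (L (i + 1)).skeleton n → (L i).skeleton n}

/-- Three thirds: one from (I) and two from (II), with centres `x` and `a`. It covers points that
are only near the contractible polyhedron. -/
theorem dist_restrict_lt_of_near (hεδ : ∀ i, 0 < ε i ∧ ε i < δ i / 3)
    (h1 : ∀ i z, dist (G i z : P i) (f i z) < ε i / 3)
    (h2 : ∀ i (y : P (i + 1)), Metric.diam (f i '' Metric.closedBall y (δ (i + 1))) < ε i / 3)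
    {i : ℕ} {x a : P (i + 1)} {z : (L (i + 1)).skeleton n} (ha : dist a x ≤ δ (i + 1))
    (hz : dist a z ≤ ε (i + 1)) : dist (G i z : P i) (f i x) < ε i := by
  have hδ := hεδ (i + 1)
  have h3 := dist_lt_of_diam_image_lt (f i) (h2 i x) (a := a) (b := x) ha
    (by simpa using (by linarith : 0 ≤ δ (i + 1)))
  have h4 := dist_lt_of_diam_image_lt (f i) (h2 i a) (a := (z : P (i + 1))) (b := a)
    (by rw [Metric.mem_closedBall, dist_comm]; linarith)
    (by simpa using (by linarith : 0 ≤ δ (i + 1)))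
  have h5 := h1 i z
  have h6 := dist_triangle4 (G i z : P i) (f i z) (f i a) (f i x)
  linarith

/-- Composites of two bonding maps between the skeleta of the balls extend over every
`(n + 1)`-dimensional space. -/
theorem exists_extension_comp (hεδ : ∀ i, 0 < ε i ∧ ε i < δ i / 3) (hG : ∀ i, Continuous (G i))
    (g : ∀ i, (L (i + 1)).skeleton (n + 1) → (L i).skeleton n) (hg : ∀ i, Continuous (g i))
    (hgG : ∀ i (z : (L (i + 1)).skeleton n), g i ⟨z, (L (i + 1)).skeleton_subset_succ n z.2⟩ = G i z)
    (h1 : ∀ i z, dist (G i z : P i) (f i z) < ε i / 3)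
    (h2 : ∀ i (y : P (i + 1)), Metric.diam (f i '' Metric.closedBall y (δ (i + 1))) < ε i / 3)
    (hmesh : ∀ i, (L i).mesh < ε i) (x : InvLimit f) (A : ∀ i, Set (P i))
    (hA : ∀ i, (L i).IsSubpolyhedron (A i)) (hAc : ∀ i, ContractibleSpace (A i))
    (hεA : ∀ i, Metric.closedBall (x.1 i) (ε i) ⊆ A i)
    (hAδ : ∀ i, A i ⊆ Metric.closedBall (x.1 i) (δ i)) (i : ℕ) {Q : Type*} [TopologicalSpace Q]
    [CompactSpace Q] [T2Space Q] (hQ : ThinSpace (n + 1) Q)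
    {j : SkeletonBall L n ε x.1 (i + 1 + 1) → Q} (hj : IsClosedEmbedding j) :
    ∃ q : Q → SkeletonBall L n ε x.1 i, Continuous q ∧
      ∀ z, (q (j z)).1 = G i (G (i + 1) z.1) := by
  have := hAc (i + 1 + 1)
  have := hAc (i + 1)
  obtain ⟨F, hF, hFj⟩ := (hA (i + 1 + 1)).exists_extension hQ hj
    (fun z => (z.1 : P (i + 1 + 1))) (by fun_prop) (fun z => hεA _ z.2)
    (fun z => (L _).skeleton_subset_succ n z.1.2)
  -- Off the `n`-skeleton nothing keeps `g` close to `f`, so `g (i + 1) (F y)` may be far from `x`.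
  -- The map `r` brings it near `A (i + 1)` and does not move the points coming from the base.
  obtain ⟨r, hr, hrA, hrd⟩ := (hA (i + 1)).exists_retraction n
  have hmem : ∀ y, (G i (r (g (i + 1) (F y))) : P i) ∈ Metric.closedBall (x.1 i) (ε i) := by
    intro y
    obtain ⟨a, ha, had⟩ := hrd (g (i + 1) (F y))
    have := dist_restrict_lt_of_near hεδ h1 h2 (hAδ (i + 1) ha) (had.trans (hmesh (i + 1)).le)
    rw [x.2 i] at this
    exact this.le
  refine ⟨fun y => ⟨G i (r (g (i + 1) (F y))), hmem y⟩,
    ((hG i).comp (hr.comp ((hg (i + 1)).comp hF))).subtype_mk hmem, fun z => ?_⟩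
  · have hFz : F (j z) = ⟨z.1, (L _).skeleton_subset_succ n z.1.2⟩ := Subtype.ext (hFj z)
    change G i (r (g (i + 1) (F (j z)))) = _
    rw [hFz, hgG (i + 1) z.1, hrA]
    exact hεA (i + 1) (restrict_mem_closedBall (A := fun i => (L i).skeleton n) (G := G) hεδ h1 h2 x z.2)

theorem isCellLikeSpace_thread_closedBall (hεδ : ∀ i, 0 < ε i ∧ ε i < δ i / 3)
    (hG : ∀ i, Continuous (G i))
    (g : ∀ i, (L (i + 1)).skeleton (n + 1) → (L i).skeleton n) (hg : ∀ i, Continuous (g i))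
    (hgG : ∀ i (z : (L (i + 1)).skeleton n), g i ⟨z, (L (i + 1)).skeleton_subset_succ n z.2⟩ = G i z)
    (h1 : ∀ i z, dist (G i z : P i) (f i z) < ε i / 3)
    (h2 : ∀ i (y : P (i + 1)), Metric.diam (f i '' Metric.closedBall y (δ (i + 1))) < ε i / 3)
    (hmesh : ∀ i, (L i).mesh < ε i) (x : InvLimit f) (A : ∀ i, Set (P i))
    (hA : ∀ i, (L i).IsSubpolyhedron (A i)) (hAc : ∀ i, ContractibleSpace (A i))
    (hεA : ∀ i, Metric.closedBall (x.1 i) (ε i) ⊆ A i)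
    (hAδ : ∀ i, A i ⊆ Metric.closedBall (x.1 i) (δ i)) :
    IsCellLikeSpace {z : InvLimit (M := fun i => (L i).skeleton n) G |
      ∀ i, (z.1 i : P i) ∈ Metric.closedBall (x.1 i) (ε i)} := by
  let K : ℕ → Type _ := SkeletonBall L n ε x.1
  have hK : ∀ i, CompactSpace (K i) := fun i => SkeletonBall.compactSpace x.1 i
  have hKne : ∀ i, Nonempty (K i) := fun i => by
    obtain ⟨z, hz⟩ := exists_skeletonBall (n := n) hmesh x.1 i
    exact ⟨⟨z, hz⟩⟩
  -- Any thin embedding will do: approximating the zero map is just a way to obtain one.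
  choose φ hφ hφi hφthin _ using fun i =>
    (((L i).thinSpace_skeleton n).of_injective (Q' := K i) Subtype.val continuous_subtype_val
      Subtype.val_injective).exists_injective_approx (m := 2 * n + 1) (by omega)
      (fun _ => 0) continuous_const one_pos
  let Ψ : (EuclideanSpace ℝ (Fin (2 * n + 1)) × ℝ) ≃L[ℝ] EuclideanSpace ℝ (Fin (2 * n + 2)) :=
    ContinuousLinearEquiv.ofFinrankEq (by simp)
  have hScomp : ∀ i, IsCompact (coneSet Ψ (φ i)) := fun i => isCompact_coneSet Ψ (hφ i)
  have hSc : ∀ i, CompactSpace (coneSet Ψ (φ i)) := fun i => isCompact_iff_compactSpace.1 (hScomp i)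
  have hSthin : ∀ i, ThinSpace (n + 1) (coneSet Ψ (φ i)) := fun i => thinSpace_coneSet Ψ (hφthin i)
  have hbase : ∀ i, Continuous (coneBase Ψ (φ i)) := fun i => continuous_coneBase Ψ (hφ i)
  have hbasei : ∀ i, Function.Injective (coneBase Ψ (φ i)) := fun i => coneBase_injective Ψ (hφi i)
  choose q hq hqeq using fun i => exists_extension_comp hεδ hG g hg hgG h1 h2 hmesh x A hA hAc hεA
    hAδ i (hSthin (i + 1 + 1)) ((hbase (i + 1 + 1)).isClosedEmbedding (hbasei (i + 1 + 1)))
  have hskel : ∀ i, CompactSpace ((L i).skeleton n) := fun i =>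
    isCompact_iff_compactSpace.1 ((L i).isClosed_skeleton n).isCompact
  have hlim : CompactSpace (InvLimit (M := fun i => (L i).skeleton n) G) :=
    InvLimit.compactSpace (M := fun i => (L i).skeleton n) G hG
  let Y := {z : InvLimit (M := fun i => (L i).skeleton n) G |
      ∀ i, (z.1 i : P i) ∈ Metric.closedBall (x.1 i) (ε i)}
  have hY : CompactSpace Y := by
    refine isCompact_iff_compactSpace.1 (IsClosed.isCompact ?_)
    have : Y = ⋂ i, {z | (z.1 i : P i) ∈ Metric.closedBall (x.1 i) (ε i)} := by
      ext
      simp [Y]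
    rw [this]
    exact isClosed_iInter fun i => Metric.isClosed_closedBall.preimage
      (continuous_subtype_val.comp ((continuous_apply i).comp continuous_subtype_val))
  let y' : Y → ∀ i, K i := fun y i => ⟨y.1.1 i, y.2 i⟩
  have hqy : ∀ y i, q i (coneBase Ψ (φ (i + 1 + 1)) (y' y (i + 1 + 1))) = y' y i := fun y i =>
    Subtype.ext (by
      rw [hqeq]
      change G i (G (i + 1) (y.1.1 (i + 1 + 1))) = y.1.1 i
      rw [y.1.2, y.1.2])
  have hydet : ∀ y₁ y₂ : Y, (∀ j, y' y₁ (2 * j) = y' y₂ (2 * j)) → y₁ = y₂ := by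
    intro y₁ y₂ heq
    have heven : ∀ j, y₁.1.1 (2 * j) = y₂.1.1 (2 * j) := fun j => congrArg Subtype.val (heq j)
    refine Subtype.ext (Subtype.ext (funext fun i => ?_))
    rcases Nat.even_or_odd' i with ⟨j, rfl | rfl⟩
    · exact heven j
    · rw [← y₁.1.2, ← y₂.1.2]
      exact congrArg (G (2 * j + 1)) (heven (j + 1))
  -- Only even stages are used, since the factorization through a cone needs two bonding maps. The
  -- cones have dimension `n + 1`, whence `ℝ^(2(n+1)+1)`.
  refine isCellLikeSpace_of_starConvex_tower (m := 2 * (n + 1) + 1) (Y := Y)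
    (S := fun j => coneSet Ψ (φ (2 * j))) (fun j => hScomp _) (fun j => starConvex_coneSet Ψ)
    (fun j => zero_mem_coneSet Ψ) ?_
    (fun j c => coneBase Ψ (φ (2 * j)) (q (2 * j) c)) (fun j => (hbase _).comp (hq _))
    (fun j y => coneBase Ψ (φ (2 * j)) (y' y (2 * j))) ?_ ?_ ?_ ?_
  · intro j ψ hψ η hη
    obtain ⟨e, he, hi, -, hd⟩ := (hSthin (2 * j)).exists_injective_approx (m := 2 * (n + 1) + 1)
      (by omega) ψ hψ hη
    exact ⟨e, he, hi, hd⟩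
  · intro j
    refine (hbase _).comp (Continuous.subtype_mk ?_ _)
    exact (continuous_apply (2 * j)).comp (continuous_subtype_val.comp continuous_subtype_val)
  · intro j y
    exact congrArg (coneBase Ψ (φ (2 * j))) (hqy y (2 * j))
  · intro y₁ y₂ heq
    exact hydet y₁ y₂ fun j => hbasei _ (heq j)
  · intro c
    let k : ∀ j, K (2 * j) := fun j => q (2 * j) (c.1 (j + 1))
    -- Every bonding map of the cones has image in the base, so a thread of cones consists of base
    -- points and comes from a thread of the `K (2 * j)`.
    have hck : ∀ j, c.1 j = coneBase Ψ (φ (2 * j)) (k j) := fun j => (c.2 j).symm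
    have hk : ∀ j, G (2 * j) (G (2 * j + 1) (k (j + 1)).1) = (k j).1 := fun j => by
      rw [← hqeq (2 * j) (k (j + 1))]
      change (q (2 * j) _).1 = (q (2 * j) (c.1 (j + 1))).1
      rw [hck (j + 1)]
      rfl
    obtain ⟨z, hz⟩ := exists_thread_of_even (M := fun i => (L i).skeleton n) G
      (fun j => (k j).1) hk
    have hzK : ∀ i, (z.1 i : P i) ∈ Metric.closedBall (x.1 i) (ε i) := by
      have hstep : ∀ i, (z.1 (i + 1) : P (i + 1)) ∈ Metric.closedBall (x.1 (i + 1)) (ε (i + 1)) →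
          (z.1 i : P i) ∈ Metric.closedBall (x.1 i) (ε i) := fun i hi => by
        have := restrict_mem_closedBall (A := fun i => (L i).skeleton n) (G := G) hεδ h1 h2 x hi
        rwa [z.2 i] at this
      have heven : ∀ j, (z.1 (2 * j) : P (2 * j)) ∈
          Metric.closedBall (x.1 (2 * j)) (ε (2 * j)) := fun j => by
        rw [hz j]
        exact (k j).2
      intro i
      rcases Nat.even_or_odd' i with ⟨j, rfl | rfl⟩
      · exact heven j
      · exact hstep (2 * j + 1) (heven (j + 1))
    refine ⟨⟨z, hzK⟩, fun j => ?_⟩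
    rw [hck j]
    exact congrArg (coneBase Ψ (φ (2 * j))) (Subtype.ext (hz j))

end Fiber

end

-- The spaces `P_1, P_2, …` of the sequence are listed as `P 0, P 1, …`: the index is shifted by one,
-- which shows only in the denominator `2 ^ i` of condition (III).
theorem lemma3p2 (n : ℕ) {P : ℕ → Type*}
    [∀ i, MetricSpace (P i)] [∀ i, CompactSpace (P i)]
    (hdiam : ∀ i, Metric.diam (univ : Set (P i)) < 1)
    -- the bonding maps of the first inverse sequence
    (f : ∀ i, P (i + 1) → P i)
    (hf : ∀ i, Continuous (f i)) (hfs : ∀ i, Function.Surjective (f i))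
    -- the triangulations
    (L : ∀ i, Triangulation (P i))
    -- the maps between the skeleta
    (g : ∀ i, (L (i + 1)).skeleton (n + 1) → (L i).skeleton (n + 1))
    (hg : ∀ i, Continuous (g i))
    (hgn : ∀ i (z : (L (i + 1)).skeleton (n + 1)),
      (z : P (i + 1)) ∈ (L (i + 1)).skeleton n → (g i z : P i) ∈ (L i).skeleton n)
    (ε δ : ℕ → ℝ)
    (hεδ : ∀ i, 0 < ε i ∧ ε i < δ i / 3 ∧ δ i / 3 < 1)
    -- (I)
    (h1 : ∀ i (z : (L (i + 1)).skeleton (n + 1)), (z : P (i + 1)) ∈ (L (i + 1)).skeleton n →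
      dist (g i z : P i) (f i z) < ε i / 3)
    -- (II)
    (h2 : ∀ i (y : P (i + 1)),
      Metric.diam (f i '' Metric.closedBall y (δ (i + 1))) < ε i / 3)
    -- (III)
    (h3 : ∀ j k (y : P (j + (k + 1))),
      Metric.diam (bondComp f j (k + 1) '' Metric.closedBall y (ε (j + (k + 1))))
        < ε j / 2 ^ (j + (k + 1) + 1)) :
    ∃ π : InvLimit (M := fun i => (L i).skeleton n)
          (fun i => skeletonRestrict (L (i + 1)) (L i) n (g i) (hgn i)) → InvLimit f,
      Continuous π ∧
      -- the bonding maps restrict to the two systems of balls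
      (∀ (x : InvLimit f) (i : ℕ) (z : (L (i + 1)).skeleton n),
        ((z : P (i + 1)) ∈ Metric.closedBall (x.1 (i + 1)) (δ (i + 1)) →
          (skeletonRestrict (L (i + 1)) (L i) n (g i) (hgn i) z : P i)
            ∈ Metric.closedBall (x.1 i) (δ i)) ∧
        ((z : P (i + 1)) ∈ Metric.closedBall (x.1 (i + 1)) (ε (i + 1)) →
          (skeletonRestrict (L (i + 1)) (L i) n (g i) (hgn i) z : P i)
            ∈ Metric.closedBall (x.1 i) (ε i))) ∧
      -- the fibers are the limits of these systems
      (∀ x : InvLimit f,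
        π ⁻¹' {x} = {z | ∀ i, (z.1 i : P i) ∈ Metric.closedBall (x.1 i) (δ i)} ∧
        π ⁻¹' {x} = {z | ∀ i, (z.1 i : P i) ∈ Metric.closedBall (x.1 i) (ε i)}) ∧
      -- (IV)
      ((∀ i, (L i).mesh < ε i) →
        ((∀ x, (π ⁻¹' {x}).Nonempty) ∧ Function.Surjective π) ∧
        -- (V)
        ((∀ i (y : P i), ∃ A : Set (P i), (L i).IsSubpolyhedron A ∧ ContractibleSpace A ∧
            Metric.closedBall y (ε i) ⊆ A ∧ A ⊆ Metric.closedBall y (δ i)) →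
          -- (VI)
          (∀ i (z : (L (i + 1)).skeleton (n + 1)), (g i z : P i) ∈ (L i).skeleton n) →
            IsCellLikeMap π)) := by
  have hεδ' : ∀ i, 0 < ε i ∧ ε i < δ i / 3 := fun i => ⟨(hεδ i).1, (hεδ i).2.1⟩
  let G : ∀ i, (L (i + 1)).skeleton n → (L i).skeleton n := fun i =>
    skeletonRestrict (L (i + 1)) (L i) n (g i) (hgn i)
  have hG : ∀ i, Continuous (G i) := fun i =>
    (continuous_subtype_val.comp ((hg i).comp (by fun_prop))).subtype_mk _
  have hG1 : ∀ i z, dist (G i z : P i) (f i z) < ε i / 3 := fun i z =>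
    h1 i ⟨z, (L (i + 1)).skeleton_subset_succ n z.2⟩ z.2
  obtain ⟨π, hπ, hfib⟩ := exists_fiber_map (A := fun i => (L i).skeleton n) (G := G) hf hεδ' hG1 h2 h3
  refine ⟨π, hπ, fun x i z => ⟨fun hz => ?_, fun hz => ?_⟩, hfib, fun hmesh => ?_⟩
  · have := dist_restrict_lt (A := fun i => (L i).skeleton n) (G := G) hεδ' hG1 h2 hz
    rw [x.2 i] at this
    exact this.le.trans (by linarith [hεδ' i])
  · exact restrict_mem_closedBall (A := fun i => (L i).skeleton n) (G := G) hεδ' hG1 h2 x hz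
  · have hne : ∀ x, (π ⁻¹' {x}).Nonempty := fun x => by
      rw [(hfib x).2]
      exact exists_thread_mem_closedBall (fun i => (L i).isClosed_skeleton n) hG hεδ' hG1 h2 x
        fun i => exists_skeletonBall hmesh x.1 i
    refine ⟨⟨hne, fun x => hne x⟩, fun h5 h6 x => ?_⟩
    rw [(hfib x).2]
    -- Contractible polyhedra are needed only around the coordinates of the one point `x`.
    choose A hA hAc hεA hAδ using fun i => h5 i (x.1 i)
    exact isCellLikeSpace_thread_closedBall hεδ' hG
      (fun i z => ⟨g i z, h6 i z⟩) (fun i => (continuous_subtype_val.comp (hg i)).subtype_mk _)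
      (fun i z => rfl) hG1 h2 hmesh x A hA hAc hεA hAδ
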